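/- **Setting.** Let $m\ge 1$ be an integer and let $\mathbb{R}_m$ be the real Clifford algebra with generators $e_1,\dots,e_m$ and relations $e_je_\ell+e_\ell e_j=-2\delta_{j\ell}$. Write $x=x_0+\underline{x}$, $\underline{x}=\sum_{j=1}^m x_je_j$, for the points of $\mathbb{R}^{m+1}$, put $r=|\underline{x}|$, and let $\Delta=\sum_{j=0}^m\partial_{x_j}^2$. Let $\Omega_2\subset\mathbb{C}$ be an intrinsic complex domain, i.e. a nonempty connected open set symmetric with respect to the real axis, and set $\Omega_1=\Omega_2\cap\mathbb{R}$, $\Omega=\{x_0+\underline{x}\in\mathbb{R}^{m+1}:(x_0,|\underline{x}|)\in\Omega_2\}$. * A holomorphic function $f(u+iv)=\alpha(u,v)+i\beta(u,v)$ on $\Omega_2$ is *intrinsic* if $f(\bar z)=\overline{f(z)}$. It induces the function $f(x_0+\underline{x})=\alpha(x_0,r)+\frac{\underline{x}}{r}\beta(x_0,r)$ on $\Omega$ (with value $\alpha(x_0,0)$ at $\underline x=0$). * $\mathcal{A}(\Omega_1)$ is the space of real-valued real analytic functions on $\Omega_1$ that extend holomorphically to $\Omega_2$; equivalently, the restrictions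 to $\Omega_1$ of the intrinsic holomorphic functions on $\Omega_2$. The slice extension map $S$ sends $f_0=\sum_i h_i|_{\Omega_1}c_i\in\mathcal{A}(\Omega_1)\otimes\mathbb{R}_m$ ($h_i$ intrinsic holomorphic, $c_i\in\mathbb{R}_m$) to $S[f_0](x)=\sum_i h_i(x_0+\underline{x})c_i$. * $\mathcal{SM}(\Omega)$ is the module of (left) slice monogenic functions: for every unit vector $\underline w$, $(\partial_u+\underline w\,\partial_v)F(u+v\underline w)=0$. * $\mathcal{AM}(\Omega)$ is the module of axially monogenic functions: real analytic $F:\Omega\to\mathbb{R}_m$ with $\partial_{x_0}F+\sum_{j=1}^m e_j\partial_{x_j}F=0$ of the form $F=A(x_0,r)+\frac{\underline x}{r}B(x_0,r)$, where $A,B:\Omega_2\to\mathbb{R}_m$ are real analytic, $A$ even and $B$ odd in the second variable. * For a real analytic $g:\Omega_1\to\mathbb{R}_m$, $\mathrm{GCK}[g]$ (the generalized CK-extension of $g$ to $\Omega$) is the function in $\mathcal{AM}(\Omega)$ that near $\Omega_1$ is the sum of the convergent series $$\Gamma\!\left(\tfrac m2\right)\sum_{k=0}^\infty\frac{(-1)^k}{k!}\left(\frac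 r2\right)^{2k}\left[\frac{g^{(2k)}(x_0)}{\Gamma(k+\frac m2)}+\frac{\underline x}{2}\,\frac{g^{(2k+1)}(x_0)}{\Gamma(k+\frac m2+1)}\right]$$ $$=\Gamma\!\left(\tfrac m2\right)\left(\tfrac{r\partial_{x_0}}2\right)^{-\frac m2}\left[\tfrac{r\partial_{x_0}}2J_{\frac m2-1}(r\partial_{x_0})+\tfrac{\underline x\partial_{x_0}}2J_{\frac m2}(r\partial_{x_0})\right]g(x_0),$$ whenever such a function exists on $\Omega$. **Theorem 4.2.** Let $m$ be odd, with the convention $(-1)!!=1$, and put $\gamma_m=(-1)^{\frac{m-1}2}\frac{(m-1)!!}{(m-2)!!}$. 1. Let $f=\alpha+i\beta$ be intrinsic holomorphic on $\Omega_2$. For every $x_0\in\Omega_1$ the limit $\left(\frac1r\partial_r\right)^{\frac{m-1}2}[\alpha](x_0,0):=\lim_{r\to0}\left(\frac1r\partial_r\right)^{\frac{m-1}2}[\alpha](x_0,r)$ exists, the function $f(x_0+\underline{x})$ is real analytic on $\Omega$, both generalized CK-extensions below exist on $\Omega$, each is the unique function in $\mathcal{AM}(\Omega)$ with the given restriction to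 $\Omega_1$, and on $\Omega$ $$\Delta^{\frac{m-1}2}\big[f(x_0+\underline x)\big]=(m-1)!!\;\mathrm{GCK}\!\left[\left(\tfrac1r\partial_r\right)^{\frac{m-1}2}[\alpha](x_0,0)\right]=\gamma_m\,\mathrm{GCK}\big[f^{(m-1)}(x_0)\big].$$ 2. For every $f_0\in\mathcal{A}(\Omega_1)\otimes\mathbb{R}_m$: $S[f_0]$ is independent of the representation of $f_0$, real analytic, and in $\mathcal{SM}(\Omega)$; $\Delta^{\frac{m-1}2}S[f_0]\in\mathcal{AM}(\Omega)$; $\gamma_m\partial_{x_0}^{m-1}f_0\in\mathcal{A}(\Omega_1)\otimes\mathbb{R}_m$; its generalized CK-extension exists on $\Omega$ and is the unique function in $\mathcal{AM}(\Omega)$ with this restriction to $\Omega_1$; and on $\Omega$ $$\Delta^{\frac{m-1}2}\,S[f_0]=\mathrm{GCK}\big[\gamma_m\,\partial_{x_0}^{m-1}f_0\big],$$ i.e. the square with top arrow $S$, right arrow $\Delta^{\frac{m-1}2}$, left arrow $\gamma_m\partial_{x_0}^{m-1}$ and bottom arrow $\mathrm{GCK}$ commutes. -/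

import Mathlib

noncomputable section

namespace FueterGCK

/-! ### The real Clifford algebra, paravectors and their vector part -/

/-- The quadratic form `v ↦ -(v₁² + ⋯ + v_m²)` on `ℝ^m`. -/
abbrev negSq (m : ℕ) : QuadraticForm ℝ (Fin m → ℝ) :=
  QuadraticMap.weightedSumSquares ℝ (fun _ : Fin m => (-1 : ℝ))

/-- The real Clifford algebra `ℝ_m`: generators `e_1, …, e_m` and relations
`e_j e_l + e_l e_j = -2 δ_{jl}`. -/
abbrev Cl (m : ℕ) : Type := CliffordAlgebra (negSq m)

/-- A vector `v ∈ ℝ^m` seen as the `1`-vector `∑ v_j e_j` of `ℝ_m`. -/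
def vec {m : ℕ} (v : Fin m → ℝ) : Cl m := CliffordAlgebra.ι (negSq m) v

/-- The generator `e_j`. -/
def gen {m : ℕ} (j : Fin m) : Cl m := vec (Pi.single j 1)

/-- The basis `(e_A)`, indexed by the subsets `A` of `{1, …, m}`, of the vector space `ℝ_m`
(transported from the exterior algebra). -/
def clBasis (m : ℕ) : Module.Basis (Finset (Fin m)) ℝ (Cl m) :=
  letI : Invertible (2 : ℝ) := invertibleOfNonzero two_ne_zero
  (Pi.basisFun ℝ (Fin m)).ExteriorAlgebra.map (CliffordAlgebra.equivExterior (negSq m)).symm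

/-- The coefficients `(a_A)` of an element of `ℝ_m`, as a vector of a Euclidean space. -/
def clCoeff (m : ℕ) : Cl m →ₗ[ℝ] EuclideanSpace ℝ (Finset (Fin m)) :=
  ((clBasis m).equivFun.trans (WithLp.linearEquiv 2 ℝ (Finset (Fin m) → ℝ)).symm).toLinearMap

theorem clCoeff_injective (m : ℕ) : Function.Injective (clCoeff m) :=
  LinearEquiv.injective _

/-- The norm `|a| = (∑_A a_A²)^{1/2}` on `ℝ_m`. Only its topology matters below (differentiation of
`ℝ_m`-valued functions), and on a finite-dimensional space all norms define the same one. -/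
instance instNormedAddCommGroupCl (m : ℕ) : NormedAddCommGroup (Cl m) :=
  NormedAddCommGroup.induced (Cl m) (EuclideanSpace ℝ (Finset (Fin m))) (clCoeff m)
    (clCoeff_injective m)

instance instNormedSpaceCl (m : ℕ) : NormedSpace ℝ (Cl m) :=
  NormedSpace.induced ℝ (Cl m) (EuclideanSpace ℝ (Finset (Fin m))) (clCoeff m)

/-- The space `ℝ^{m+1}` of paravectors `x = x_0 + x_1 e_1 + ⋯ + x_m e_m`, with its Euclidean
structure. -/
abbrev Para (m : ℕ) : Type := EuclideanSpace ℝ (Fin (m + 1))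

/-- The paravector `x_0 + v`. -/
def para {m : ℕ} (x₀ : ℝ) (v : Fin m → ℝ) : Para m :=
  WithLp.toLp 2 (Fin.cons x₀ v : Fin (m + 1) → ℝ)

/-- The vector part `x_1 e_1 + ⋯ + x_m e_m ∈ ℝ_m` of a paravector. -/
def vecPart {m : ℕ} (x : Para m) : Cl m := vec (fun j : Fin m => x j.succ)

/-- The Euclidean norm `r` of the vector part of a paravector. -/
def rad {m : ℕ} (x : Para m) : ℝ := Real.sqrt (∑ j : Fin m, x j.succ ^ 2)

/-! ### Domains and intrinsic holomorphic functions -/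

/-- Intrinsic complex domains: connected open sets, symmetric with respect to the real axis. -/
def IsIntrinsicDomain (D : Set ℂ) : Prop :=
  IsOpen D ∧ IsConnected D ∧ ∀ z ∈ D, (starRingEnd ℂ) z ∈ D

/-- The intersection of `D` with the real line. -/
def realTrace (D : Set ℂ) : Set ℝ := {x₀ | (x₀ : ℂ) ∈ D}

/-- The axially symmetric slice domain `{x_0 + x : (x_0, |x|) ∈ D}` of `ℝ^{m+1}`. -/
def axialDomain (m : ℕ) (D : Set ℂ) : Set (Para m) := {x | (⟨x 0, rad x⟩ : ℂ) ∈ D}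

/-- Holomorphic intrinsic functions on `D`. -/
def IsIntrinsicHol (D : Set ℂ) (f : ℂ → ℂ) : Prop :=
  DifferentiableOn ℂ f D ∧ ∀ z ∈ D, f ((starRingEnd ℂ) z) = (starRingEnd ℂ) (f z)

/-- `α(u, v)`, the real part of `f(u + iv)`. -/
def alphaPart (f : ℂ → ℂ) (u v : ℝ) : ℝ := (f ⟨u, v⟩).re

/-- `β(u, v)`, the imaginary part of `f(u + iv)`. -/
def betaPart (f : ℂ → ℂ) (u v : ℝ) : ℝ := (f ⟨u, v⟩).im

/-! ### Slice monogenic functions and the slice extension -/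

/-- (Left) slice monogenic functions on `Ω`: for each unit vector `w` the function
`(u, v) ↦ F(u + v w)` is differentiable and killed by `∂_u + w ∂_v`. -/
def IsSliceMonogenicOn {m : ℕ} (Ω : Set (Para m)) (F : Para m → Cl m) : Prop :=
  ∀ w : Fin m → ℝ, ∑ j, w j ^ 2 = 1 →
    ∀ z : ℂ, para z.re (z.im • w) ∈ Ω →
      DifferentiableAt ℝ (fun ζ : ℂ => F (para ζ.re (ζ.im • w))) z ∧
      fderiv ℝ (fun ζ : ℂ => F (para ζ.re (ζ.im • w))) z 1
        + vec w * fderiv ℝ (fun ζ : ℂ => F (para ζ.re (ζ.im • w))) z Complex.I = 0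

/-- The extension of `f = α + iβ` to paravectors:
`f(x_0 + x) = α(x_0, |x|) + (x / |x|) β(x_0, |x|)`, with the value `α(x_0, 0)` at `x = 0`. -/
def sliceExtC (m : ℕ) (f : ℂ → ℂ) (x : Para m) : Cl m :=
  algebraMap ℝ (Cl m) (alphaPart f (x 0) (rad x))
    + ((rad x)⁻¹ * betaPart f (x 0) (rad x)) • vecPart x

/-- `g = ∑ h_i|_ℝ c_i` on the real trace of `D`, for intrinsic holomorphic `h_i` on `D`
and `c_i ∈ ℝ_m`. -/
def IsHolRep {m : ℕ} (D : Set ℂ) {n : ℕ} (h : Fin n → ℂ → ℂ) (c : Fin n → Cl m)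
    (g : ℝ → Cl m) : Prop :=
  (∀ i, IsIntrinsicHol D (h i)) ∧
    ∀ x₀ ∈ realTrace D, g x₀ = ∑ i, alphaPart (h i) x₀ 0 • c i

/-- The module `𝒜(Ω₁) ⊗ ℝ_m`, `Ω₁ = D ∩ ℝ`: the `ℝ_m`-valued functions on `Ω₁` whose components
are real analytic functions with a holomorphic extension to `D`. -/
def MemA {m : ℕ} (D : Set ℂ) (g : ℝ → Cl m) : Prop :=
  ∃ (n : ℕ) (h : Fin n → ℂ → ℂ) (c : Fin n → Cl m), IsHolRep D h c g

open Classical in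
/-- The slice extension map `S` on `𝒜(Ω₁) ⊗ ℝ_m`: extend the components holomorphically to `D`,
then apply `sliceExtC` to them. -/
def sliceExt (m : ℕ) (D : Set ℂ) (g : ℝ → Cl m) : Para m → Cl m :=
  if H : MemA D g then
    fun x => ∑ i, sliceExtC m (H.choose_spec.choose i) x * H.choose_spec.choose_spec.choose i
  else 0

/-! ### Axially monogenic functions and the generalized CK-extension -/

/-- (Left) monogenic functions on `Ω`: `C¹` functions with
`∂_{x_0} F + ∑ e_j ∂_{x_j} F = 0` on `Ω`. -/
def IsMonogenicOn {m : ℕ} (Ω : Set (Para m)) (F : Para m → Cl m) : Prop :=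
  ContDiffOn ℝ 1 F Ω ∧
    ∀ x ∈ Ω, fderiv ℝ F x (EuclideanSpace.single 0 1)
      + ∑ j : Fin m, gen j * fderiv ℝ F x (EuclideanSpace.single j.succ 1) = 0

/-- The module `𝒜ℳ(Ω)` of axially monogenic functions on `Ω = axialDomain m D`: real analytic
monogenic functions of the form `A(x_0, |x|) + (x / |x|) B(x_0, |x|)` with `ℝ_m`-valued real
analytic functions `A` (even in the second variable) and `B` (odd in it) on `D`. -/
def IsAxialMonogenic {m : ℕ} (D : Set ℂ) (F : Para m → Cl m) : Prop :=
  AnalyticOnNhd ℝ F (axialDomain m D) ∧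
  IsMonogenicOn (axialDomain m D) F ∧
  ∃ A B : ℂ → Cl m, AnalyticOnNhd ℝ A D ∧ AnalyticOnNhd ℝ B D ∧
    (∀ z ∈ D, A ((starRingEnd ℂ) z) = A z) ∧ (∀ z ∈ D, B ((starRingEnd ℂ) z) = -B z) ∧
    ∀ x ∈ axialDomain m D,
      F x = A ⟨x 0, rad x⟩ + ((rad x)⁻¹ • vecPart x) * B ⟨x 0, rad x⟩

/-- The coefficients of the Bessel function
`J_ν(z) = ∑_k (-1)^k / (k! Γ(k + ν + 1)) (z / 2)^{2k + ν}`. -/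
def besselCoeff (ν : ℝ) (k : ℕ) : ℝ :=
  (-1) ^ k / ((k.factorial : ℝ) * Real.Gamma (k + ν + 1))

/-- The `k`-th term of the series
`Γ(m/2) (|x|∂/2)^{-m/2} [ (|x|∂/2) J_{m/2-1}(|x|∂) + (x∂/2) J_{m/2}(|x|∂) ] g (x_0)`, `∂ = ∂_{x_0}`;
the powers of `|x|∂/2` multiply to `(|x|∂/2)^{2k}` in both summands. -/
def gckTerm {m : ℕ} (g : ℝ → Cl m) (x : Para m) (k : ℕ) : Cl m :=
  (Real.Gamma ((m : ℝ) / 2) * (rad x / 2) ^ (2 * k)) •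
    (besselCoeff ((m : ℝ) / 2 - 1) k • iteratedDeriv (2 * k) g (x 0)
      + besselCoeff ((m : ℝ) / 2) k •
          (((1 / 2 : ℝ) • vecPart x) * iteratedDeriv (2 * k + 1) g (x 0)))

/-- `F` is the generalized CK-extension of `g` to `Ω = axialDomain m D`: it is axially monogenic on
`Ω`, and on a neighbourhood of the real trace of `D` it is the sum of the Bessel series of `g`. -/
def IsGCKExtension {m : ℕ} (D : Set ℂ) (g : ℝ → Cl m) (F : Para m → Cl m) : Prop :=
  IsAxialMonogenic D F ∧
    ∀ x₀ ∈ realTrace D, ∀ᶠ x in nhds (para x₀ 0 : Para m), HasSum (gckTerm g x) (F x)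

open Classical in
/-- The operator `GCK` (with values in functions on `axialDomain m D`). -/
def GCK (m : ℕ) (D : Set ℂ) (g : ℝ → Cl m) : Para m → Cl m :=
  if H : ∃ F : Para m → Cl m, IsGCKExtension D g F then H.choose else 0

/-- `GCK[g]` is defined on `axialDomain m D`, has the values `g` on the real line, and is there the
only axially monogenic function with these values. -/
def GCKWellDefined (m : ℕ) (D : Set ℂ) (g : ℝ → Cl m) : Prop :=
  IsGCKExtension D g (GCK m D g) ∧
  (∀ x₀ ∈ realTrace D, GCK m D g (para x₀ 0) = g x₀) ∧
  ∀ F : Para m → Cl m, IsAxialMonogenic D F → (∀ x₀ ∈ realTrace D, F (para x₀ 0) = g x₀) →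
    Set.EqOn F (GCK m D g) (axialDomain m D)

/-! ### The differential operators -/

/-- The `k`-th power of the Laplace operator of `ℝ^{m+1}`. -/
def laplacePow {m : ℕ} (k : ℕ) (F : Para m → Cl m) : Para m → Cl m :=
  (fun G : Para m → Cl m => Laplacian.laplacian G)^[k] F

/-- `((1/r) ∂_r)^k a`, at `r ≠ 0`. -/
def radialOp (k : ℕ) (a : ℝ → ℝ) : ℝ → ℝ :=
  (fun b : ℝ → ℝ => fun r => r⁻¹ * deriv b r)^[k] a

/-- `((1/r) ∂_r)^k [α] (x_0, 0)`: the value at `r = 0` is the limit for `r → 0`. -/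
def radialAtZero (k : ℕ) (f : ℂ → ℂ) (x₀ : ℝ) : ℝ :=
  Filter.limUnder (nhdsWithin (0 : ℝ) {0}ᶜ) (radialOp k (alphaPart f x₀))

/-- `γ_m = (-1)^{(m-1)/2} (m-1)!! / (m-2)!!` for odd `m`; for `m = 1` the truncated subtraction
gives `0!! = 1`, in accordance with the convention `(-1)!! = 1`. -/
def gammaConst (m : ℕ) : ℝ :=
  (-1) ^ ((m - 1) / 2) * ((Nat.doubleFactorial (m - 1) : ℝ) / (Nat.doubleFactorial (m - 2) : ℝ))

end FueterGCK

end

/-!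
In the variables `u` and `s = v²`, an intrinsic holomorphic function is `A(u, s) + i v B(u, s)`
with `A`, `B` real analytic, and it induces `A(x₀, r²) + x B(x₀, r²)` on `ℝ^{m+1}`. The
Cauchy–Riemann equations become the Vekua system `∂_u A = 2 s ∂_s B + μ B`, `∂_u B = -2 ∂_s A`
with `μ = 1`, and the same system with `μ = m` says that the induced function is monogenic.
On a solution with parameter `μ`, the Laplacian acts as `2 (m - μ) ∂_s`, and `∂_s` raises the
parameter by `2`; hence `Δ^{(m-1)/2}` leads from `μ = 1` to `μ = m`. An axially monogenic function
is recovered from its restriction to the real axis by the Bessel series, so the two formulas only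
have to be compared on the axis, where `(r⁻¹ ∂_r)^k = 2^k ∂_s^k` and `∂_u² = -2 μ ∂_s`.
-/

noncomputable section

namespace FueterGCK

open Filter Topology

/-! ### Directional derivatives -/

section DirDeriv

variable {V E : Type*} [NormedAddCommGroup V] [NormedSpace ℝ V]
  [NormedAddCommGroup E] [NormedSpace ℝ E] {F G : V → E} {p : V}

/-- The derivative of `F` in the direction `e`, as an operator on functions that can be iterated. -/
def dirDeriv (e : V) (F : V → E) (p : V) : E := fderiv ℝ F p e

theorem dirDeriv_congr (h : F =ᶠ[𝓝 p] G) (e : V) : dirDeriv e F =ᶠ[𝓝 p] dirDeriv e G := by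
  filter_upwards [h.fderiv (𝕜 := ℝ)] with q hq
  rw [dirDeriv, dirDeriv, hq]

theorem dirDeriv_iterate_congr (h : F =ᶠ[𝓝 p] G) (e : V) (k : ℕ) :
    (dirDeriv e)^[k] F =ᶠ[𝓝 p] (dirDeriv e)^[k] G := by
  induction k with
  | zero => exact h
  | succ k ih => simpa only [Function.iterate_succ_apply'] using dirDeriv_congr ih e

theorem dirDeriv_add (hF : DifferentiableAt ℝ F p) (hG : DifferentiableAt ℝ G p) (e : V) :
    dirDeriv e (fun q => F q + G q) p = dirDeriv e F p + dirDeriv e G p := by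
  simp [dirDeriv, fderiv_fun_add hF hG]

theorem dirDeriv_smul {c : V → ℝ} (hc : DifferentiableAt ℝ c p) (hG : DifferentiableAt ℝ G p)
    (e : V) : dirDeriv e (fun q => c q • G q) p = c p • dirDeriv e G p + dirDeriv e c p • G p := by
  simp [dirDeriv, fderiv_fun_smul hc hG]

theorem dirDeriv_const_smul (c : ℝ) (hG : DifferentiableAt ℝ G p) (e : V) :
    dirDeriv e (fun q => c • G q) p = c • dirDeriv e G p := by
  simp [dirDeriv, fderiv_fun_const_smul hG]

theorem dirDeriv_clm {E' : Type*} [NormedAddCommGroup E'] [NormedSpace ℝ E'] (l : E →L[ℝ] E')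
    (hG : DifferentiableAt ℝ G p) (e : V) :
    dirDeriv e (fun q => l (G q)) p = l (dirDeriv e G p) := by
  have h : HasFDerivAt (fun q => l (G q)) (l.comp (fderiv ℝ G p)) p :=
    l.hasFDerivAt.comp p hG.hasFDerivAt
  simp only [dirDeriv, h.fderiv, ContinuousLinearMap.comp_apply]

variable [CompleteSpace E]

theorem analyticAt_dirDeriv (h : AnalyticAt ℝ F p) (e : V) : AnalyticAt ℝ (dirDeriv e F) p :=
  (ContinuousLinearMap.analyticAt (ContinuousLinearMap.apply ℝ E e) _).comp h.fderiv

theorem analyticAt_dirDeriv_iterate (h : AnalyticAt ℝ F p) (e : V) (k : ℕ) :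
    AnalyticAt ℝ ((dirDeriv e)^[k] F) p := by
  induction k with
  | zero => exact h
  | succ k ih => rw [Function.iterate_succ_apply']; exact analyticAt_dirDeriv ih e

theorem differentiableAt_dirDeriv (h : AnalyticAt ℝ F p) (e : V) :
    DifferentiableAt ℝ (dirDeriv e F) p :=
  (analyticAt_dirDeriv h e).differentiableAt

theorem dirDeriv_dirDeriv (h : AnalyticAt ℝ F p) (e e' : V) :
    dirDeriv e (dirDeriv e' F) p = fderiv ℝ (fderiv ℝ F) p e e' := by
  unfold dirDeriv
  rw [fderiv_clm_apply h.fderiv.differentiableAt (differentiableAt_const e')]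
  simp

theorem dirDeriv_comm (h : AnalyticAt ℝ F p) (e e' : V) :
    dirDeriv e (dirDeriv e' F) p = dirDeriv e' (dirDeriv e F) p := by
  rw [dirDeriv_dirDeriv h, dirDeriv_dirDeriv h]
  exact h.contDiffAt.isSymmSndFDerivAt_of_omega.eq e e'

theorem dirDeriv_iterate_add (hF : AnalyticAt ℝ F p) (hG : AnalyticAt ℝ G p) (e : V) (k : ℕ) :
    (dirDeriv e)^[k] (fun q => F q + G q) p = (dirDeriv e)^[k] F p + (dirDeriv e)^[k] G p := by
  induction k generalizing p with
  | zero => rfl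
  | succ k ih =>
    have hev : (dirDeriv e)^[k] (fun q => F q + G q) =ᶠ[𝓝 p]
        fun q => (dirDeriv e)^[k] F q + (dirDeriv e)^[k] G q := by
      filter_upwards [hF.eventually_analyticAt, hG.eventually_analyticAt] with q hq hq'
        using ih hq hq'
    simp only [Function.iterate_succ_apply']
    rw [(dirDeriv_congr hev e).eq_of_nhds,
      dirDeriv_add (analyticAt_dirDeriv_iterate hF e k).differentiableAt
        (analyticAt_dirDeriv_iterate hG e k).differentiableAt]

theorem dirDeriv_iterate_clm {E' : Type*} [NormedAddCommGroup E'] [NormedSpace ℝ E']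
    (l : E →L[ℝ] E') (hG : AnalyticAt ℝ G p) (e : V) (k : ℕ) :
    (dirDeriv e)^[k] (fun q => l (G q)) p = l ((dirDeriv e)^[k] G p) := by
  induction k generalizing p with
  | zero => rfl
  | succ k ih =>
    have hev : (dirDeriv e)^[k] (fun q => l (G q)) =ᶠ[𝓝 p] fun q => l ((dirDeriv e)^[k] G q) := by
      filter_upwards [hG.eventually_analyticAt] with q hq using ih hq
    simp only [Function.iterate_succ_apply']
    rw [(dirDeriv_congr hev e).eq_of_nhds,
      dirDeriv_clm l (analyticAt_dirDeriv_iterate hG e k).differentiableAt]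

theorem iteratedFDeriv_const_apply (h : AnalyticAt ℝ F p) (e : V) (k : ℕ) :
    iteratedFDeriv ℝ k F p (fun _ => e) = (dirDeriv e)^[k] F p := by
  induction k generalizing p with
  | zero => simp
  | succ k ih =>
    have hev : (fun q => iteratedFDeriv ℝ k F q (fun _ => e)) =ᶠ[𝓝 p] (dirDeriv e)^[k] F := by
      filter_upwards [h.eventually_analyticAt] with q hq using ih hq
    have hd : DifferentiableAt ℝ (iteratedFDeriv ℝ k F) p :=
      (h.contDiffAt (n := (k + 1 : ℕ))).differentiableAt_iteratedFDeriv
        (by exact_mod_cast Nat.lt_succ_self k)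
    rw [iteratedFDeriv_succ_apply_left, Function.iterate_succ_apply',
      ← (dirDeriv_congr hev e).eq_of_nhds, dirDeriv,
      (hd.hasFDerivAt.continuousMultilinear_apply_const (fun _ : Fin k => e)).fderiv]
    rfl

end DirDeriv

/-! ### The Vekua system in the variables `(u, s) = (u, v²)` -/

/-- The partial derivative `∂_u` of functions of `(u, s)`. -/
local notation "∂ᵤ" => dirDeriv ((1, 0) : ℝ × ℝ)

/-- The partial derivative `∂_s` of functions of `(u, s)`. -/
local notation "∂ₛ" => dirDeriv ((0, 1) : ℝ × ℝ)

section Vekua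

variable {E : Type*} [NormedAddCommGroup E] [NormedSpace ℝ E] {A B : ℝ × ℝ → E} {p : ℝ × ℝ}
  {μ : ℝ}

/-- Near `p`, the functions `A` and `B` are analytic and solve the Vekua system
`∂_u A = 2 s ∂_s B + μ B`, `∂_u B = -2 ∂_s A`. For `s = v²` and `μ = 1` these are the
Cauchy–Riemann equations of `A + i v B`; for `μ = m` they express that `A + x B` with
`x ∈ ℝ^m`, `s = |x|²`, is monogenic. -/
def VekuaAt (μ : ℝ) (A B : ℝ × ℝ → E) (p : ℝ × ℝ) : Prop :=
  AnalyticAt ℝ A p ∧ AnalyticAt ℝ B p ∧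
    ∀ᶠ q in 𝓝 p, ∂ᵤ A q = (2 * q.2) • ∂ₛ B q + μ • B q ∧ ∂ᵤ B q = (-2 : ℝ) • ∂ₛ A q

theorem vekuaAt_zero : VekuaAt μ (fun _ => (0 : E)) (fun _ => 0) p := by
  refine ⟨analyticAt_const, analyticAt_const, .of_forall fun q => ?_⟩
  simp [dirDeriv]

theorem dirDeriv_two_snd_smul (hB : DifferentiableAt ℝ B p) (e : ℝ × ℝ) :
    dirDeriv e (fun q => (2 * q.2) • B q) p = (2 * p.2) • dirDeriv e B p + (2 * e.2) • B p := by
  have hf : HasFDerivAt (fun q : ℝ × ℝ => 2 * q.2) ((2 : ℝ) • ContinuousLinearMap.snd ℝ ℝ ℝ) p :=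
    hasFDerivAt_snd.const_mul 2
  rw [dirDeriv_smul hf.differentiableAt hB]
  congr 2
  simp [dirDeriv, hf.fderiv]

theorem hasDerivAt_axis {u : ℝ} (hA : AnalyticAt ℝ A (u, 0)) :
    HasDerivAt (fun t : ℝ => A (t, 0)) (∂ᵤ A (u, 0)) u :=
  hA.differentiableAt.hasFDerivAt.comp_hasDerivAt u
    ((hasDerivAt_id u).prodMk (hasDerivAt_const u (0 : ℝ)))

variable [CompleteSpace E]

theorem VekuaAt.eventually (h : VekuaAt μ A B p) : ∀ᶠ q in 𝓝 p, VekuaAt μ A B q := by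
  filter_upwards [h.1.eventually_analyticAt, h.2.1.eventually_analyticAt,
    h.2.2.eventually_nhds] with q hA hB hAB using ⟨hA, hB, hAB⟩

theorem VekuaAt.clm {E' : Type*} [NormedAddCommGroup E'] [NormedSpace ℝ E']
    (h : VekuaAt μ A B p) (l : E →L[ℝ] E') :
    VekuaAt μ (fun q => l (A q)) (fun q => l (B q)) p := by
  refine ⟨(l.analyticAt _).comp h.1, (l.analyticAt _).comp h.2.1, ?_⟩
  filter_upwards [h.eventually] with q ⟨hA, hB, hAB⟩
  have hl {F : ℝ × ℝ → E} (hF : AnalyticAt ℝ F q) (e : ℝ × ℝ) :=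
    dirDeriv_clm l hF.differentiableAt e
  obtain ⟨h1, h2⟩ := hAB.self_of_nhds
  rw [hl hA, hl hA, hl hB, hl hB, h1, h2]
  simp

theorem VekuaAt.add {A' B' : ℝ × ℝ → E} (h : VekuaAt μ A B p) (h' : VekuaAt μ A' B' p) :
    VekuaAt μ (fun q => A q + A' q) (fun q => B q + B' q) p := by
  refine ⟨h.1.add h'.1, h.2.1.add h'.2.1, ?_⟩
  filter_upwards [h.eventually, h'.eventually] with q ⟨hA, hB, hAB⟩ ⟨hA', hB', hAB'⟩
  have hadd {F G : ℝ × ℝ → E} (hF : AnalyticAt ℝ F q) (hG : AnalyticAt ℝ G q) (e : ℝ × ℝ) :=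
    dirDeriv_add hF.differentiableAt hG.differentiableAt e
  obtain ⟨h1, h2⟩ := hAB.self_of_nhds
  obtain ⟨h1', h2'⟩ := hAB'.self_of_nhds
  rw [hadd hA hA', hadd hA hA', hadd hB hB', hadd hB hB', h1, h2, h1', h2']
  constructor <;> module

theorem VekuaAt.sum {ι : Type*} (t : Finset ι) {A B : ι → ℝ × ℝ → E}
    (h : ∀ i ∈ t, VekuaAt μ (A i) (B i) p) :
    VekuaAt μ (fun q => ∑ i ∈ t, A i q) (fun q => ∑ i ∈ t, B i q) p := by
  classical
  induction t using Finset.induction_on with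
  | empty => simpa only [Finset.sum_empty] using vekuaAt_zero
  | insert i t hi ih =>
    simp only [Finset.sum_insert hi]
    exact (h i (Finset.mem_insert_self i t)).add
      (ih fun j hj => h j (Finset.mem_insert_of_mem hj))

theorem VekuaAt.du_ds (h : VekuaAt μ A B p) :
    ∂ᵤ (∂ₛ A) p = (2 * p.2) • ∂ₛ (∂ₛ B) p + (μ + 2) • ∂ₛ B p ∧
      ∂ᵤ (∂ₛ B) p = (-2 : ℝ) • ∂ₛ (∂ₛ A) p := by
  obtain ⟨hA, hB, he⟩ := h
  have hA' := differentiableAt_dirDeriv hA (0, 1)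
  have hB' := differentiableAt_dirDeriv hB (0, 1)
  constructor
  · have hduA : ∂ᵤ A =ᶠ[𝓝 p] fun q => (2 * q.2) • ∂ₛ B q + μ • B q := he.mono fun _ h => h.1
    rw [dirDeriv_comm hA, (dirDeriv_congr hduA (0, 1)).eq_of_nhds,
      dirDeriv_add (by fun_prop) (by fun_prop), dirDeriv_two_snd_smul hB',
      dirDeriv_const_smul _ hB.differentiableAt]
    module
  · have hduB : ∂ᵤ B =ᶠ[𝓝 p] fun q => (-2 : ℝ) • ∂ₛ A q := he.mono fun _ h => h.2
    rw [dirDeriv_comm hB, (dirDeriv_congr hduB (0, 1)).eq_of_nhds,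
      dirDeriv_const_smul _ hA']

theorem VekuaAt.ds_ds (h : VekuaAt μ A B p) : VekuaAt (μ + 2) (∂ₛ A) (∂ₛ B) p :=
  ⟨analyticAt_dirDeriv h.1 _, analyticAt_dirDeriv h.2.1 _, h.eventually.mono fun _ hq => hq.du_ds⟩

theorem VekuaAt.ds_iterate (h : VekuaAt μ A B p) (k : ℕ) :
    VekuaAt (μ + 2 * k) (∂ₛ^[k] A) (∂ₛ^[k] B) p := by
  induction k with
  | zero => simpa using h
  | succ k ih =>
    rw [Function.iterate_succ_apply', Function.iterate_succ_apply']
    convert ih.ds_ds using 1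
    push_cast; ring

theorem VekuaAt.du_du_fst (h : VekuaAt μ A B p) :
    ∂ᵤ (∂ᵤ A) p = (-4 * p.2) • ∂ₛ (∂ₛ A) p - (2 * μ) • ∂ₛ A p := by
  have hB' := differentiableAt_dirDeriv h.2.1 (0, 1)
  have hB := h.2.1.differentiableAt
  have hduA : ∂ᵤ A =ᶠ[𝓝 p] fun q => (2 * q.2) • ∂ₛ B q + μ • B q :=
    h.2.2.mono fun _ h => h.1
  rw [(dirDeriv_congr hduA (1, 0)).eq_of_nhds, dirDeriv_add (by fun_prop) (by fun_prop),
    dirDeriv_two_snd_smul hB', dirDeriv_const_smul _ hB, h.du_ds.2, h.2.2.self_of_nhds.2]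
  module

theorem VekuaAt.du_du_snd (h : VekuaAt μ A B p) :
    ∂ᵤ (∂ᵤ B) p =
      (-4 * p.2) • ∂ₛ (∂ₛ B) p - (2 * (μ + 2)) • ∂ₛ B p := by
  have hduB : ∂ᵤ B =ᶠ[𝓝 p] fun q => (-2 : ℝ) • ∂ₛ A q := h.2.2.mono fun _ h => h.2
  rw [(dirDeriv_congr hduB (1, 0)).eq_of_nhds,
    dirDeriv_const_smul _ (differentiableAt_dirDeriv h.1 _), h.du_ds.1]
  module

theorem iteratedDeriv_two_axis {u : ℝ} (hA : AnalyticAt ℝ A (u, 0)) :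
    iteratedDeriv 2 (fun t : ℝ => A (t, 0)) u = ∂ᵤ (∂ᵤ A) (u, 0) := by
  have hderiv : deriv (fun t : ℝ => A (t, 0)) =ᶠ[𝓝 u] fun t => ∂ᵤ A (t, 0) := by
    have hcont : ContinuousAt (fun t : ℝ => ((t, 0) : ℝ × ℝ)) u := by fun_prop
    filter_upwards [hcont.eventually hA.eventually_analyticAt] with t ht
    exact (hasDerivAt_axis ht).deriv
  rw [iteratedDeriv_succ, iteratedDeriv_one, hderiv.deriv_eq,
    (hasDerivAt_axis (analyticAt_dirDeriv hA _)).deriv]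

theorem VekuaAt.iteratedDeriv_axis {U : Set ℝ} (hU : IsOpen U)
    (h : ∀ u ∈ U, VekuaAt 1 A B (u, 0)) {g : ℝ → E} (hg : ∀ u ∈ U, g u = A (u, 0)) (n : ℕ) :
    ∀ u ∈ U, iteratedDeriv (2 * n) g u =
      ((-2) ^ n * ((2 * n - 1).doubleFactorial : ℝ)) • ∂ₛ^[n] A (u, 0) := by
  induction n with
  | zero => intro u hu; simp [hg u hu]
  | succ n ih =>
    intro u hu
    set c : ℝ := (-2) ^ n * ((2 * n - 1).doubleFactorial : ℝ) with hc
    have hV := (h u hu).ds_iterate n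
    have hev : iteratedDeriv (2 * n) g =ᶠ[𝓝 u] fun t => c • ∂ₛ^[n] A (t, 0) := by
      filter_upwards [hU.mem_nhds hu] with v hv using ih v hv
    calc iteratedDeriv (2 * (n + 1)) g u = iteratedDeriv 2 (iteratedDeriv (2 * n) g) u := by
          rw [iteratedDeriv_eq_iterate, iteratedDeriv_eq_iterate, iteratedDeriv_eq_iterate,
            ← Function.iterate_add_apply, mul_add, mul_one, add_comm]
      _ = ∂ᵤ (∂ᵤ fun q => c • ∂ₛ^[n] A q) (u, 0) := by
          rw [hev.iteratedDeriv_eq 2,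
            iteratedDeriv_two_axis (A := fun q => c • ∂ₛ^[n] A q) (hV.1.const_smul)]
      _ = c • ∂ᵤ (∂ᵤ (∂ₛ^[n] A)) (u, 0) := by
          have hdu : ∂ᵤ (fun q => c • ∂ₛ^[n] A q) =ᶠ[𝓝 (u, 0)]
              fun q => c • ∂ᵤ (∂ₛ^[n] A) q := by
            filter_upwards [hV.1.eventually_analyticAt] with q hq
            exact dirDeriv_const_smul c hq.differentiableAt _
          rw [(dirDeriv_congr hdu _).eq_of_nhds,
            dirDeriv_const_smul c (differentiableAt_dirDeriv hV.1 _)]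
      _ = _ := by
          rw [hV.du_du_fst, Function.iterate_succ_apply', show 2 * (n + 1) - 1 = 2 * n + 1 by lia,
            Nat.doubleFactorial_add_one, hc]
          push_cast
          module

end Vekua

/-! ### Even and odd parts of holomorphic functions -/

section EvenOdd

variable {f : ℂ → ℂ} {c : ℂ}

theorem exists_hasSum_powers (A : Type*) [NormedRing A] [NormOneClass A] [NormedAlgebra ℂ A]
    [CompleteSpace A] (hf : AnalyticAt ℂ f c) :
    ∃ ρ > 0, ∃ (a : ℕ → ℂ) (Φ : A → A), AnalyticOnNhd ℂ Φ (Metric.ball 0 ρ) ∧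
      (∀ T ∈ Metric.ball 0 ρ, HasSum (fun n => a n • T ^ n) (Φ T)) ∧
      ∀ y ∈ Metric.ball 0 ρ, HasSum (fun n => a n * y ^ n) (f (c + y)) := by
  obtain ⟨ps, R, hps⟩ := hf
  obtain ⟨ρ, hρ, hρR⟩ := ENNReal.lt_iff_exists_nnreal_btwn.1 hps.r_pos
  set q := FormalMultilinearSeries.ofScalars A ps.coeff
  have hq_radius : (ρ : ENNReal) ≤ q.radius := by
    obtain ⟨C, -, hC⟩ := ps.norm_mul_pow_le_of_lt_radius (hρR.trans_le hps.r_le)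
    refine q.le_radius_of_bound C fun n => ?_
    rw [FormalMultilinearSeries.ofScalars_norm, ← ps.norm_apply_eq_norm_coef]
    exact hC n
  have hq := (q.hasFPowerSeriesOnBall (hρ.trans_le hq_radius)).mono hρ hq_radius
  refine ⟨ρ, by exact_mod_cast hρ, ps.coeff, q.sum, ?_, fun T hT => ?_, fun y hy => ?_⟩
  · rw [← Metric.eball_coe]; exact hq.analyticOnNhd
  · rw [← Metric.eball_coe] at hT
    simpa [q, FormalMultilinearSeries.ofScalars_apply_eq] using hq.hasSum hT
  · rw [← Metric.eball_coe] at hy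
    have hsum := hps.hasSum (Metric.eball_subset_eball hρR.le hy)
    simpa only [ps.apply_eq_pow_smul_coeff, smul_eq_mul, mul_comm] using hsum

/-- The operator `(x, y) ↦ (τ x - (s / ε) y, ε x + τ y)` on `ℂ²`, where `p = (τ, s)`. Its
eigenvalues are `τ + w`, `w² = -s`, so that `f(rotOp ε p)` encodes the values `f(τ + w)` while
depending analytically on `p`. The parameter `ε ≠ 0` makes the operator small. -/
def rotOp (ε : ℂ) (p : ℂ × ℂ) : ℂ × ℂ →L[ℂ] ℂ × ℂ :=
  p.1 • ContinuousLinearMap.id ℂ (ℂ × ℂ)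
    + (ε • (ContinuousLinearMap.inr ℂ ℂ ℂ).comp (ContinuousLinearMap.fst ℂ ℂ ℂ)
      - (p.2 / ε) • (ContinuousLinearMap.inl ℂ ℂ ℂ).comp (ContinuousLinearMap.snd ℂ ℂ ℂ))

theorem rotOp_apply (ε : ℂ) (p v : ℂ × ℂ) :
    rotOp ε p v = (p.1 * v.1 - p.2 / ε * v.2, ε * v.1 + p.1 * v.2) := by
  ext
  · simp [rotOp, sub_eq_add_neg]
  · simp [rotOp, add_comm]

/-- The left eigenvector `(x, y) ↦ x + (w / ε) y` of `rotOp ε (τ, -w²)`. -/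
def rotEigen (ε w : ℂ) : ℂ × ℂ →L[ℂ] ℂ :=
  ContinuousLinearMap.fst ℂ ℂ ℂ + (w / ε) • ContinuousLinearMap.snd ℂ ℂ ℂ

theorem rotEigen_apply (ε w : ℂ) (v : ℂ × ℂ) : rotEigen ε w v = v.1 + w / ε * v.2 := by
  simp [rotEigen]

theorem rotEigen_rotOp_pow {ε w : ℂ} (hε : ε ≠ 0) {p : ℂ × ℂ} (hw : w ^ 2 = -p.2) (n : ℕ)
    (v : ℂ × ℂ) : rotEigen ε w ((rotOp ε p ^ n) v) = (p.1 + w) ^ n * rotEigen ε w v := by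
  induction n with
  | zero => simp
  | succ n ih =>
    have hs : p.2 = -w ^ 2 := by rw [hw, neg_neg]
    have h1 (v : ℂ × ℂ) : rotEigen ε w (rotOp ε p v) = (p.1 + w) * rotEigen ε w v := by
      simp only [rotEigen_apply, rotOp_apply, hs]
      field_simp
      ring
    rw [pow_succ', mul_apply_eq_comp, h1, ih, pow_succ']
    ring

theorem eq_rotEigen_of_hasSum {ε w : ℂ} (hε : ε ≠ 0) {p : ℂ × ℂ} (hw : w ^ 2 = -p.2) {a : ℕ → ℂ}
    {y : ℂ} (hy : HasSum (fun n => a n * (p.1 + w) ^ n) y) {S : ℂ × ℂ →L[ℂ] ℂ × ℂ}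
    (hS : HasSum (fun n => a n • rotOp ε p ^ n) S) : y = rotEigen ε w (S (1, 0)) := by
  have hev := (rotEigen ε w).hasSum
    ((ContinuousLinearMap.apply ℂ (ℂ × ℂ) ((1, 0) : ℂ × ℂ)).hasSum hS)
  have hpow (n : ℕ) : rotEigen ε w ((a n • rotOp ε p ^ n) (1, 0)) = a n * (p.1 + w) ^ n := by
    rw [smul_apply, map_smul, smul_eq_mul, rotEigen_rotOp_pow hε hw]
    simp [rotEigen_apply]
  simp only [ContinuousLinearMap.apply_apply, hpow] at hev
  exact hy.unique hev

theorem exists_rotOp_mem_ball {ρ : ℝ} (hρ : 0 < ρ) :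
    ∃ ε : ℂ, ε ≠ 0 ∧ rotOp ε 0 ∈ Metric.ball 0 ρ := by
  have hcont : Continuous fun ε : ℂ => rotOp ε 0 := by
    simp only [rotOp, Prod.fst_zero, Prod.snd_zero, zero_div]
    fun_prop
  have hzero : rotOp 0 0 = 0 := by ext <;> simp [rotOp]
  have hev : ∀ᶠ ε in 𝓝 (0 : ℂ), rotOp ε 0 ∈ Metric.ball 0 ρ :=
    hcont.continuousAt.eventually (Metric.isOpen_ball.mem_nhds (by simpa [hzero] using hρ))
  obtain ⟨ε, hmem, hε⟩ := ((hev.filter_mono nhdsWithin_le_nhds).and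
    (self_mem_nhdsWithin : {0}ᶜ ∈ 𝓝[≠] (0 : ℂ))).exists
  exact ⟨ε, hε, hmem⟩

theorem analyticAt_rotOp_sub (ε c : ℂ) (p : ℂ × ℂ) :
    AnalyticAt ℂ (fun p : ℂ × ℂ => rotOp ε (p - (c, 0))) p := by
  have hsub : AnalyticAt ℂ (fun p : ℂ × ℂ => p - (c, 0)) p := analyticAt_id.sub analyticAt_const
  have hfst : AnalyticAt ℂ (fun p : ℂ × ℂ => (p - (c, 0)).1) p := analyticAt_fst.comp hsub
  have hsnd : AnalyticAt ℂ (fun p : ℂ × ℂ => (p - (c, 0)).2) p := analyticAt_snd.comp hsub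
  exact (hfst.smul analyticAt_const).add
    (analyticAt_const.sub (hsnd.div_const.smul analyticAt_const))

theorem exists_eventually_eq_add_mul (hf : AnalyticAt ℂ f c) :
    ∃ P Q : ℂ × ℂ → ℂ, AnalyticAt ℂ P (c, 0) ∧ AnalyticAt ℂ Q (c, 0) ∧
      ∀ᶠ p in 𝓝 (c, 0), ∀ w : ℂ, w ^ 2 = -p.2 → f (p.1 + w) = P p + w * Q p := by
  obtain ⟨ρ, hρ, a, Φ, hΦ, hΦsum, hfsum⟩ := exists_hasSum_powers (ℂ × ℂ →L[ℂ] ℂ × ℂ) hf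
  obtain ⟨ε, hε, hmem⟩ := exists_rotOp_mem_ball hρ
  set T : ℂ × ℂ → (ℂ × ℂ →L[ℂ] ℂ × ℂ) := fun p => rotOp ε (p - (c, 0))
  have hT := analyticAt_rotOp_sub ε c (c, 0)
  have hTmem : T (c, 0) ∈ Metric.ball 0 ρ := by simpa [T] using hmem
  have hΦT : AnalyticAt ℂ (fun p => Φ (T p) (1, 0)) (c, 0) :=
    (ContinuousLinearMap.analyticAt (ContinuousLinearMap.apply ℂ (ℂ × ℂ) ((1, 0) : ℂ × ℂ)) _).comp
      ((hΦ _ hTmem).comp hT)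
  refine ⟨fun p => (Φ (T p) (1, 0)).1, fun p => (Φ (T p) (1, 0)).2 / ε,
    analyticAt_fst.comp hΦT, (analyticAt_snd.comp hΦT).div_const, ?_⟩
  have hsmall : ∀ᶠ p : ℂ × ℂ in 𝓝 (c, 0), ‖p.1 - c‖ < ρ / 2 ∧ ‖p.2‖ < (ρ / 2) ^ 2 := by
    have h1 : ContinuousAt (fun p : ℂ × ℂ => ‖p.1 - c‖) (c, 0) := by fun_prop
    have h2 : ContinuousAt (fun p : ℂ × ℂ => ‖p.2‖) (c, 0) := by fun_prop
    exact (h1.eventually_lt_const (by simpa using hρ)).and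
      (h2.eventually_lt_const (by simpa using by positivity))
  filter_upwards [hT.continuousAt.eventually (Metric.isOpen_ball.mem_nhds hTmem), hsmall]
    with p hp ⟨hu, hs⟩ w hw
  have hwnorm : ‖w‖ < ρ / 2 := by
    refine lt_of_pow_lt_pow_left₀ 2 (by positivity) ?_
    rwa [← norm_pow, hw, norm_neg]
  have hy : (p - (c, 0)).1 + w ∈ Metric.ball 0 ρ := by
    rw [mem_ball_zero_iff, Prod.fst_sub]
    linarith [norm_add_le (p.1 - c) w]
  have hfw := eq_rotEigen_of_hasSum hε (by simpa using hw) (hfsum _ hy) (hΦsum _ hp)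
  rw [rotEigen_apply, Prod.fst_sub, ← add_assoc, add_sub_cancel] at hfw
  rw [hfw, mul_div_assoc', div_mul_eq_mul_div]

/-- The square root `i √s` of `-s`. -/
def negRoot (s : ℂ) : ℂ := Complex.I * s ^ (1 / 2 : ℂ)

theorem negRoot_sq (s : ℂ) : negRoot s ^ 2 = -s := by
  rw [negRoot, mul_pow, ← Complex.cpow_nat_mul]
  simp

theorem analyticAt_negRoot {s : ℂ} (hs : s ∈ Complex.slitPlane) : AnalyticAt ℂ negRoot s := by
  unfold negRoot
  fun_prop (disch := assumption)

/-- The even part in `w` of `f(u + w)`, as a function of `(u, -w²)`. -/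
def evenPart (f : ℂ → ℂ) (p : ℂ × ℂ) : ℂ := (f (p.1 + negRoot p.2) + f (p.1 - negRoot p.2)) / 2

/-- The odd part in `w` of `f(u + w)`, divided by `w`, as a function of `(u, -w²)`. -/
def oddPart (f : ℂ → ℂ) (p : ℂ × ℂ) : ℂ := dslope f (p.1 - negRoot p.2) (p.1 + negRoot p.2)

theorem negRoot_mul_oddPart (f : ℂ → ℂ) (p : ℂ × ℂ) :
    negRoot p.2 * oddPart f p = (f (p.1 + negRoot p.2) - f (p.1 - negRoot p.2)) / 2 := by
  have h := sub_smul_dslope f (p.1 - negRoot p.2) (p.1 + negRoot p.2)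
  rw [smul_eq_mul] at h
  rw [← h, oddPart]
  ring

theorem evenPart_add_mul_oddPart (f : ℂ → ℂ) {p : ℂ × ℂ} {w : ℂ} (hw : w ^ 2 = -p.2) :
    evenPart f p + w * oddPart f p = f (p.1 + w) := by
  have hodd := negRoot_mul_oddPart f p
  rcases sq_eq_sq_iff_eq_or_eq_neg.1 (hw.trans (negRoot_sq p.2).symm) with rfl | rfl
  · rw [hodd, evenPart]; ring
  · rw [neg_mul, hodd, evenPart, ← sub_eq_add_neg p.1]; ring

theorem oddPart_of_snd_eq_zero (f : ℂ → ℂ) {p : ℂ × ℂ} (hp : p.2 = 0) :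
    oddPart f p = deriv f p.1 := by
  simp [oddPart, negRoot, hp, dslope_same]

theorem hasDerivAt_of_eventually_eq_add_mul {P Q : ℂ × ℂ → ℂ} {q : ℂ × ℂ} {w : ℂ}
    (hP : DifferentiableAt ℂ P q) (hQ : DifferentiableAt ℂ Q q) (hw : w ^ 2 = -q.2)
    (h : ∀ᶠ p in 𝓝 q, ∀ w : ℂ, w ^ 2 = -p.2 → f (p.1 + w) = P p + w * Q p) :
    HasDerivAt f (fderiv ℂ P q (0, 1) * (-2 * w) + (Q q + w * (fderiv ℂ Q q (0, 1) * (-2 * w))))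
      (q.1 + w) := by
  have hq : (q.1, -(q.1 + w - q.1) ^ 2) = q := by
    ext
    · rfl
    · linear_combination -hw
  have hsub : HasDerivAt (fun x => x - q.1) 1 (q.1 + w) := (hasDerivAt_id _).sub_const _
  have hcurve : HasDerivAt (fun x => (q.1, -(x - q.1) ^ 2)) ((-2 * w) • ((0, 1) : ℂ × ℂ))
      (q.1 + w) :=
    ((hasDerivAt_const _ _).prodMk (hsub.fun_pow 2).fun_neg).congr_deriv (by simp)
  have hcomp {F : ℂ × ℂ → ℂ} (hF : DifferentiableAt ℂ F q) :
      HasDerivAt (fun x => F (q.1, -(x - q.1) ^ 2)) (fderiv ℂ F q (0, 1) * (-2 * w)) (q.1 + w) :=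
    (hF.hasFDerivAt.comp_hasDerivAt_of_eq _ hcurve hq.symm).congr_deriv (by
      rw [map_smul, smul_eq_mul, mul_comm])
  refine ((hcomp hP).add (hsub.mul (hcomp hQ))).congr_of_eventuallyEq ?_ |>.congr_deriv ?_
  · have htend := hcurve.continuousAt.tendsto
    rw [hq] at htend
    filter_upwards [htend.eventually h] with x hx
    simpa using hx (x - q.1) (by simp)
  · rw [hq]; ring

theorem analyticAt_evenPart_axis (hf : AnalyticAt ℂ f c) : AnalyticAt ℂ (evenPart f) (c, 0) := by
  obtain ⟨P, Q, hP, -, h⟩ := exists_eventually_eq_add_mul hf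
  refine hP.congr (h.mono fun p hp => ?_)
  rw [evenPart, hp _ (negRoot_sq p.2), sub_eq_add_neg,
    hp (-negRoot p.2) (by rw [neg_sq, negRoot_sq])]
  ring

theorem analyticAt_oddPart_axis (hf : AnalyticAt ℂ f c) : AnalyticAt ℂ (oddPart f) (c, 0) := by
  obtain ⟨P, Q, hP, hQ, h⟩ := exists_eventually_eq_add_mul hf
  refine hQ.congr ?_
  filter_upwards [h.eventually_nhds, hP.eventually_analyticAt, hQ.eventually_analyticAt]
    with p hp hPp hQp
  by_cases hs : p.2 = 0
  · have hderiv := hasDerivAt_of_eventually_eq_add_mul (w := 0) hPp.differentiableAt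
      hQp.differentiableAt (by simp [hs]) hp
    rw [oddPart_of_snd_eq_zero f hs]
    simpa using hderiv.deriv.symm
  · have hw : negRoot p.2 ≠ 0 := fun h0 => hs (by simpa [h0] using (negRoot_sq p.2).symm)
    refine mul_left_cancel₀ hw ?_
    rw [negRoot_mul_oddPart, hp.self_of_nhds _ (negRoot_sq p.2), sub_eq_add_neg p.1,
      hp.self_of_nhds (-negRoot p.2) (by rw [neg_sq, negRoot_sq])]
    ring

theorem analyticAt_comp_add_negRoot {p : ℂ × ℂ} (hp : p.2 ∈ Complex.slitPlane)
    (h : AnalyticAt ℂ f (p.1 + negRoot p.2)) :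
    AnalyticAt ℂ (fun q : ℂ × ℂ => f (q.1 + negRoot q.2)) p :=
  h.fun_comp (f := fun q : ℂ × ℂ => q.1 + negRoot q.2)
    (analyticAt_fst.add ((analyticAt_negRoot hp).comp analyticAt_snd))

theorem analyticAt_comp_sub_negRoot {p : ℂ × ℂ} (hp : p.2 ∈ Complex.slitPlane)
    (h : AnalyticAt ℂ f (p.1 - negRoot p.2)) :
    AnalyticAt ℂ (fun q : ℂ × ℂ => f (q.1 - negRoot q.2)) p :=
  h.fun_comp (f := fun q : ℂ × ℂ => q.1 - negRoot q.2)
    (analyticAt_fst.sub ((analyticAt_negRoot hp).comp analyticAt_snd))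

theorem analyticAt_evenPart {p : ℂ × ℂ} (hp : p.2 ∈ Complex.slitPlane)
    (hadd : AnalyticAt ℂ f (p.1 + negRoot p.2)) (hsub : AnalyticAt ℂ f (p.1 - negRoot p.2)) :
    AnalyticAt ℂ (evenPart f) p :=
  ((analyticAt_comp_add_negRoot hp hadd).add (analyticAt_comp_sub_negRoot hp hsub)).div_const

theorem analyticAt_oddPart {p : ℂ × ℂ} (hp : p.2 ∈ Complex.slitPlane)
    (hadd : AnalyticAt ℂ f (p.1 + negRoot p.2)) (hsub : AnalyticAt ℂ f (p.1 - negRoot p.2)) :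
    AnalyticAt ℂ (oddPart f) p := by
  have hroot : AnalyticAt ℂ (fun q : ℂ × ℂ => negRoot q.2) p :=
    (analyticAt_negRoot hp).comp analyticAt_snd
  have hne : ∀ᶠ q : ℂ × ℂ in 𝓝 p, negRoot q.2 ≠ 0 :=
    hroot.continuousAt.eventually_ne fun h0 => Complex.slitPlane_ne_zero hp (by
      simpa [h0] using (negRoot_sq p.2).symm)
  refine (((analyticAt_comp_add_negRoot hp hadd).sub
    (analyticAt_comp_sub_negRoot hp hsub)).div_const (c := 2) |>.div hroot
      hne.self_of_nhds).congr ?_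
  filter_upwards [hne] with q hq
  exact (eq_div_of_mul_eq hq ((mul_comm _ _).trans (negRoot_mul_oddPart f q))).symm

theorem hasDerivAt_of_evenPart_of_oddPart {q : ℂ × ℂ} {w : ℂ}
    (hP : DifferentiableAt ℂ (evenPart f) q) (hQ : DifferentiableAt ℂ (oddPart f) q)
    (hw : w ^ 2 = -q.2) :
    HasDerivAt f (fderiv ℂ (evenPart f) q (1, 0) + w * fderiv ℂ (oddPart f) q (1, 0))
      (q.1 + w) := by
  have hq : (q.1 + w - w, q.2) = q := by simp
  have hcurve : HasDerivAt (fun x => (x - w, q.2)) ((1, 0) : ℂ × ℂ) (q.1 + w) :=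
    ((hasDerivAt_id _).sub_const w).prodMk (hasDerivAt_const _ _)
  refine ((hP.hasFDerivAt.comp_hasDerivAt_of_eq _ hcurve hq.symm).add
    ((hQ.hasFDerivAt.comp_hasDerivAt_of_eq _ hcurve hq.symm).const_mul w)).congr_of_eventuallyEq
      (.of_forall fun x => ?_)
  simpa using (evenPart_add_mul_oddPart f (p := (x - w, q.2)) hw).symm

theorem cauchyRiemann_evenPart_oddPart_of_ne_zero {q : ℂ × ℂ}
    (hP : DifferentiableAt ℂ (evenPart f) q) (hQ : DifferentiableAt ℂ (oddPart f) q)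
    (hq : q.2 ≠ 0) :
    fderiv ℂ (evenPart f) q (1, 0) = 2 * q.2 * fderiv ℂ (oddPart f) q (0, 1) + oddPart f q ∧
      fderiv ℂ (oddPart f) q (1, 0) = -2 * fderiv ℂ (evenPart f) q (0, 1) := by
  have hkey (w : ℂ) (hw : w ^ 2 = -q.2) :=
    (hasDerivAt_of_evenPart_of_oddPart hP hQ hw).unique <|
      hasDerivAt_of_eventually_eq_add_mul hP hQ hw <|
        .of_forall fun p w hw => (evenPart_add_mul_oddPart f hw).symm
  have hw := negRoot_sq q.2
  have hw0 : negRoot q.2 ≠ 0 := fun h0 => hq (by simpa [h0] using hw.symm)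
  have hplus := hkey _ hw
  have hminus := hkey (-negRoot q.2) (by rw [neg_sq, hw])
  constructor
  · linear_combination (hplus + hminus) / 2 - 2 * fderiv ℂ (oddPart f) q (0, 1) * hw
  · refine mul_left_cancel₀ hw0 ?_
    linear_combination (hplus - hminus) / 2

theorem cauchyRiemann_evenPart_oddPart {q : ℂ × ℂ} (hP : AnalyticAt ℂ (evenPart f) q)
    (hQ : AnalyticAt ℂ (oddPart f) q) :
    fderiv ℂ (evenPart f) q (1, 0) = 2 * q.2 * fderiv ℂ (oddPart f) q (0, 1) + oddPart f q ∧
      fderiv ℂ (oddPart f) q (1, 0) = -2 * fderiv ℂ (evenPart f) q (0, 1) := by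
  by_cases hq : q.2 ≠ 0
  · exact cauchyRiemann_evenPart_oddPart_of_ne_zero hP.differentiableAt hQ.differentiableAt hq
  have hline : ContinuousAt (fun t : ℂ => (q.1, t)) q.2 := by fun_prop
  have hcont {F : ℂ × ℂ → ℂ} (hF : AnalyticAt ℂ F q) (e : ℂ × ℂ) :
      ContinuousAt (fun t => fderiv ℂ F (q.1, t) e) q.2 :=
    (hF.fderiv.continuousAt.clm_apply continuousAt_const).comp
      (f := fun t : ℂ => (q.1, t)) (x := q.2) hline
  have hev : ∀ᶠ t in 𝓝[≠] q.2,
      fderiv ℂ (evenPart f) (q.1, t) (1, 0) =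
          2 * t * fderiv ℂ (oddPart f) (q.1, t) (0, 1) + oddPart f (q.1, t) ∧
        fderiv ℂ (oddPart f) (q.1, t) (1, 0) = -2 * fderiv ℂ (evenPart f) (q.1, t) (0, 1) := by
    filter_upwards [self_mem_nhdsWithin,
      (hline.eventually hP.eventually_analyticAt).filter_mono nhdsWithin_le_nhds,
      (hline.eventually hQ.eventually_analyticAt).filter_mono nhdsWithin_le_nhds] with t ht hPt hQt
    exact cauchyRiemann_evenPart_oddPart_of_ne_zero hPt.differentiableAt hQt.differentiableAt
      (not_not.1 hq ▸ ht)
  have hQ' : ContinuousAt (fun t => oddPart f (q.1, t)) q.2 :=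
    hQ.continuousAt.comp (f := fun t : ℂ => (q.1, t)) (x := q.2) hline
  constructor
  · exact (((hcont hP _).eventuallyEq_nhds_iff_eventuallyEq_nhdsNE
      (((continuousAt_const.mul continuousAt_id).mul (hcont hQ _)).add hQ')).1
        (hev.mono fun _ h => h.1)).eq_of_nhds
  · exact (((hcont hQ _).eventuallyEq_nhds_iff_eventuallyEq_nhdsNE
      (continuousAt_const.mul (hcont hP _))).1 (hev.mono fun _ h => h.2)).eq_of_nhds

end EvenOdd

section Intrinsic

/-- The real part of `P`, restricted to `ℝ × ℝ`. -/
def realRestrict (P : ℂ × ℂ → ℂ) (q : ℝ × ℝ) : ℝ := (P (q.1, q.2)).re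

theorem analyticAt_realRestrict {P : ℂ × ℂ → ℂ} {q : ℝ × ℝ}
    (hP : AnalyticAt ℂ P ((q.1 : ℂ), (q.2 : ℂ))) : AnalyticAt ℝ (realRestrict P) q :=
  (Complex.reCLM.analyticAt _).comp <| hP.restrictScalars.comp
    (f := fun q : ℝ × ℝ => ((q.1 : ℂ), (q.2 : ℂ)))
    ((Complex.ofRealCLM.prodMap Complex.ofRealCLM).analyticAt q)

theorem dirDeriv_realRestrict {P : ℂ × ℂ → ℂ} {q : ℝ × ℝ}
    (hP : DifferentiableAt ℂ P ((q.1 : ℂ), (q.2 : ℂ))) (e : ℝ × ℝ) :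
    dirDeriv e (realRestrict P) q = (fderiv ℂ P (q.1, q.2) (e.1, e.2)).re := by
  have h : HasFDerivAt (realRestrict P) _ q := Complex.reCLM.hasFDerivAt.comp q <|
    (hP.hasFDerivAt.restrictScalars ℝ).comp q
      (Complex.ofRealCLM.prodMap Complex.ofRealCLM).hasFDerivAt
  rw [dirDeriv, h.fderiv]
  rfl

theorem vekuaAt_realRestrict {f : ℂ → ℂ} {p : ℝ × ℝ}
    (hP : AnalyticAt ℂ (evenPart f) ((p.1 : ℂ), (p.2 : ℂ)))
    (hQ : AnalyticAt ℂ (oddPart f) ((p.1 : ℂ), (p.2 : ℂ))) :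
    VekuaAt 1 (realRestrict (evenPart f)) (realRestrict (oddPart f)) p := by
  refine ⟨analyticAt_realRestrict hP, analyticAt_realRestrict hQ, ?_⟩
  have hcoe : ContinuousAt (fun q : ℝ × ℝ => ((q.1 : ℂ), (q.2 : ℂ))) p := by fun_prop
  filter_upwards [hcoe.eventually hP.eventually_analyticAt,
    hcoe.eventually hQ.eventually_analyticAt] with q hP hQ
  obtain ⟨h1, h2⟩ := cauchyRiemann_evenPart_oddPart hP hQ
  simp only [dirDeriv_realRestrict hP.differentiableAt, dirDeriv_realRestrict hQ.differentiableAt,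
    Complex.ofReal_one, Complex.ofReal_zero, h1, h2]
  simp [realRestrict]

variable {D : Set ℂ} {f : ℂ → ℂ} {z : ℂ}

theorem I_mul_im_sq (z : ℂ) : (Complex.I * z.im) ^ 2 = -((z.im ^ 2 : ℝ) : ℂ) := by
  rw [mul_pow, Complex.I_sq]
  push_cast
  ring

theorem re_add_I_mul_im (z : ℂ) : (z.re : ℂ) + Complex.I * z.im = z := by
  rw [mul_comm, Complex.re_add_im]

theorem re_sub_I_mul_im (z : ℂ) : (z.re : ℂ) - Complex.I * z.im = starRingEnd ℂ z := by
  apply Complex.ext <;> simp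

theorem IsIntrinsicHol.analyticAt_evenPart_oddPart (hD : IsIntrinsicDomain D)
    (hf : IsIntrinsicHol D f) (hz : z ∈ D) :
    AnalyticAt ℂ (evenPart f) ((z.re : ℂ), ((z.im ^ 2 : ℝ) : ℂ)) ∧
      AnalyticAt ℂ (oddPart f) ((z.re : ℂ), ((z.im ^ 2 : ℝ) : ℂ)) := by
  have hfa (w : ℂ) (hw : w ∈ D) : AnalyticAt ℂ f w :=
    hf.1.analyticOnNhd hD.1 w hw
  by_cases hv : z.im = 0
  · have hre : (z.re : ℂ) ∈ D := by
      rwa [← Complex.conj_eq_iff_re.1 (Complex.conj_eq_iff_im.2 hv)] at hz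
    simp only [hv, ne_eq, OfNat.ofNat_ne_zero, not_false_eq_true, zero_pow, Complex.ofReal_zero]
    exact ⟨analyticAt_evenPart_axis (hfa _ hre), analyticAt_oddPart_axis (hfa _ hre)⟩
  · have hslit : ((z.im ^ 2 : ℝ) : ℂ) ∈ Complex.slitPlane :=
      Complex.ofReal_mem_slitPlane.2 (by positivity)
    have hmem : (z.re : ℂ) + negRoot ((z.im ^ 2 : ℝ) : ℂ) ∈ D ∧
        (z.re : ℂ) - negRoot ((z.im ^ 2 : ℝ) : ℂ) ∈ D := by
      rcases sq_eq_sq_iff_eq_or_eq_neg.1 ((negRoot_sq _).trans (I_mul_im_sq z).symm) with h | h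
      · rw [h, re_add_I_mul_im, re_sub_I_mul_im]; exact ⟨hz, hD.2.2 z hz⟩
      · rw [h, sub_neg_eq_add, ← sub_eq_add_neg, re_add_I_mul_im, re_sub_I_mul_im]
        exact ⟨hD.2.2 z hz, hz⟩
    exact ⟨analyticAt_evenPart hslit (hfa _ hmem.1) (hfa _ hmem.2),
      analyticAt_oddPart hslit (hfa _ hmem.1) (hfa _ hmem.2)⟩

theorem IsIntrinsicHol.vekuaAt (hD : IsIntrinsicDomain D) (hf : IsIntrinsicHol D f) (hz : z ∈ D) :
    VekuaAt 1 (realRestrict (evenPart f)) (realRestrict (oddPart f)) (z.re, z.im ^ 2) :=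
  have h := hf.analyticAt_evenPart_oddPart hD hz
  vekuaAt_realRestrict h.1 h.2

theorem IsIntrinsicHol.re_im_eq (hf : IsIntrinsicHol D f) (hz : z ∈ D) :
    (f z).re = realRestrict (evenPart f) (z.re, z.im ^ 2) ∧
      (f z).im = z.im * realRestrict (oddPart f) (z.re, z.im ^ 2) := by
  have hplus := evenPart_add_mul_oddPart f (p := (z.re, ((z.im ^ 2 : ℝ) : ℂ))) (I_mul_im_sq z)
  have hminus := evenPart_add_mul_oddPart f (p := (z.re, ((z.im ^ 2 : ℝ) : ℂ)))
    (w := -(Complex.I * z.im)) (by rw [neg_sq, I_mul_im_sq])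
  rw [re_add_I_mul_im] at hplus
  rw [← sub_eq_add_neg (z.re : ℂ), re_sub_I_mul_im, hf.2 z hz] at hminus
  have hre1 := congrArg Complex.re hplus
  have hre2 := congrArg Complex.re hminus
  have him1 := congrArg Complex.im hplus
  have him2 := congrArg Complex.im hminus
  simp only [Complex.ofReal_pow, neg_mul, neg_neg, Complex.add_re, Complex.add_im, Complex.neg_re,
    Complex.neg_im, Complex.mul_re, Complex.mul_im, Complex.I_re, Complex.I_im, Complex.ofReal_re,
    Complex.ofReal_im, Complex.conj_re, Complex.conj_im, zero_mul, mul_zero, one_mul, sub_self,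
    zero_sub, zero_add] at hre1 hre2 him1 him2
  simp only [realRestrict]
  constructor <;> push_cast <;> linarith

end Intrinsic

/-! ### Functions of axial type -/

section Clifford

variable {m : ℕ}

instance instFiniteDimensionalCl (m : ℕ) : FiniteDimensional ℝ (Cl m) :=
  Module.Finite.of_basis (clBasis m)

instance instCompleteSpaceCl (m : ℕ) : CompleteSpace (Cl m) := FiniteDimensional.complete ℝ (Cl m)

/-- The multiplication of `ℝ_m` as a continuous bilinear map; the norm of `Cl m` is not
submultiplicative, so `ContinuousLinearMap.mul` does not apply. -/
def mulL (m : ℕ) : Cl m →L[ℝ] Cl m →L[ℝ] Cl m :=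
  (LinearMap.mul ℝ (Cl m)).toContinuousBilinearMap

/-- `vecPart` as a continuous linear map. -/
def vecPartL (m : ℕ) : Para m →L[ℝ] Cl m :=
  LinearMap.toContinuousLinearMap ((CliffordAlgebra.ι (negSq m)).comp
    (LinearMap.pi fun j : Fin m => (EuclideanSpace.proj (𝕜 := ℝ) j.succ).toLinearMap))

/-- The pair `(x_0, |x|²)`, in which functions of axial type are analytic. -/
def axisCoord (x : Para m) : ℝ × ℝ := (x 0, ∑ j : Fin m, x j.succ ^ 2)

/-- The unit vector of the coordinate `x_i`. -/
abbrev unitVec (i : Fin (m + 1)) : Para m := EuclideanSpace.single i 1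

theorem vec_mul_vec (v : Fin m → ℝ) :
    vec v * vec v = algebraMap ℝ (Cl m) (-∑ j, v j ^ 2) := by
  rw [vec, CliffordAlgebra.ι_sq_scalar, QuadraticMap.weightedSumSquares_apply]
  simp [sq]

theorem vec_mul_vec_mul (v : Fin m → ℝ) (y : Cl m) :
    vec v * (vec v * y) = (-∑ j, v j ^ 2) • y := by
  rw [← mul_assoc, vec_mul_vec, Algebra.smul_def]

theorem vec_eq_sum (v : Fin m → ℝ) : vec v = ∑ j, v j • gen j := by
  conv_lhs => rw [pi_eq_sum_univ' v]
  simp only [vec, gen, map_sum, map_smul, Pi.single]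

theorem gen_mul_gen_self (j : Fin m) : gen j * gen j = (-1 : Cl m) := by
  rw [gen, vec_mul_vec]
  simp [Pi.single_apply]

theorem sum_gen_mul_gen_mul (y : Cl m) : ∑ j : Fin m, gen j * (gen j * y) = (-(m : ℝ)) • y := by
  simp [← mul_assoc, gen_mul_gen_self, ← Nat.cast_smul_eq_nsmul ℝ]

theorem sum_smul_gen_mul (x : Para m) (y : Cl m) :
    ∑ j : Fin m, x j.succ • (gen j * y) = vecPart x * y := by
  simp only [vecPart, vec_eq_sum, Finset.sum_mul, smul_mul_assoc]

theorem vecPart_mul_vecPart_mul (x : Para m) (y : Cl m) :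
    vecPart x * (vecPart x * y) = (-(axisCoord x).2) • y := by
  rw [vecPart, vec_mul_vec_mul, axisCoord]

theorem vecPart_unitVec_zero : vecPart (unitVec 0 : Para m) = 0 := by
  simp [vecPart, vec_eq_sum, unitVec, Fin.succ_ne_zero]

theorem vecPart_unitVec_succ (j : Fin m) : vecPart (unitVec j.succ : Para m) = gen j := by
  rw [vecPart, gen]
  congr 1
  ext i
  simp [unitVec, Pi.single_apply]

theorem rad_sq (x : Para m) : rad x ^ 2 = (axisCoord x).2 :=
  Real.sq_sqrt (Finset.sum_nonneg fun _ _ => sq_nonneg _)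

theorem analyticAt_coord (i : Fin (m + 1)) (x : Para m) : AnalyticAt ℝ (fun y : Para m => y i) x :=
  (EuclideanSpace.proj i : Para m →L[ℝ] ℝ).analyticAt x

theorem analyticAt_axisCoord (x : Para m) : AnalyticAt ℝ axisCoord x :=
  (analyticAt_coord 0 x).prod
    (Finset.analyticAt_fun_sum _ fun j _ => (analyticAt_coord j.succ x).fun_pow 2)

theorem analyticAt_vecPart_mul {G : Para m → Cl m} {x : Para m} (hG : AnalyticAt ℝ G x) :
    AnalyticAt ℝ (fun y => vecPart y * G y) x :=
  ((mulL m).analyticAt_bilinear _).comp_of_eq (((vecPartL m).analyticAt x).prod hG) rfl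

theorem dirDeriv_coord (i : Fin (m + 1)) (x e : Para m) :
    dirDeriv e (fun y : Para m => y i) x = e i :=
  congrArg (· e) (EuclideanSpace.proj i : Para m →L[ℝ] ℝ).fderiv

theorem dirDeriv_vecPart_mul {G : Para m → Cl m} {x : Para m} (hG : DifferentiableAt ℝ G x)
    (e : Para m) :
    dirDeriv e (fun y => vecPart y * G y) x = vecPart x * dirDeriv e G x + vecPart e * G x := by
  have h : HasFDerivAt (fun y => vecPart y * G y) _ x :=
    (mulL m).hasFDerivAt_of_bilinear (vecPartL m).hasFDerivAt hG.hasFDerivAt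
  rw [dirDeriv, h.fderiv]
  rfl

theorem dirDeriv_axisCoord (x e : Para m) :
    dirDeriv e axisCoord x = (e 0, ∑ j : Fin m, 2 * x j.succ * e j.succ) := by
  have hsq : HasFDerivAt (fun y : Para m => ∑ j : Fin m, y j.succ ^ 2)
      (∑ j : Fin m, (2 * x j.succ) • (EuclideanSpace.proj j.succ : Para m →L[ℝ] ℝ)) x :=
    HasFDerivAt.fun_sum fun j _ => by
      simpa using ((EuclideanSpace.proj j.succ : Para m →L[ℝ] ℝ).hasFDerivAt (x := x)).pow 2
  have h : HasFDerivAt axisCoord _ x :=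
    (EuclideanSpace.proj 0 : Para m →L[ℝ] ℝ).hasFDerivAt.prodMk hsq
  rw [dirDeriv, h.fderiv]
  simp

theorem dirDeriv_axisCoord_zero (x : Para m) : dirDeriv (unitVec 0) axisCoord x = (1, 0) := by
  simp [dirDeriv_axisCoord, Fin.succ_ne_zero]

theorem dirDeriv_axisCoord_succ (x : Para m) (j : Fin m) :
    dirDeriv (unitVec j.succ) axisCoord x = (0, 2 * x j.succ) := by
  simp [dirDeriv_axisCoord, (Fin.succ_ne_zero j).symm]

theorem laplacian_eq_sum_dirDeriv {F : Para m → Cl m} {x : Para m} (hF : AnalyticAt ℝ F x) :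
    Laplacian.laplacian F x = dirDeriv (unitVec 0) (dirDeriv (unitVec 0) F) x
      + ∑ j : Fin m, dirDeriv (unitVec j.succ) (dirDeriv (unitVec j.succ) F) x := by
  rw [InnerProductSpace.laplacian_eq_iteratedFDeriv_orthonormalBasis F
    (EuclideanSpace.basisFun (Fin (m + 1)) ℝ),
    ← Fin.sum_univ_succ (fun i => dirDeriv (unitVec i) (dirDeriv (unitVec i) F) x)]
  refine Finset.sum_congr rfl fun i _ => ?_
  rw [EuclideanSpace.basisFun_apply]
  refine Eq.trans ?_ (iteratedFDeriv_const_apply hF (unitVec i) 2)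
  congr 1
  ext k : 1
  fin_cases k <;> rfl

end Clifford

section AxialFn

variable {m : ℕ} {A B : ℝ × ℝ → Cl m} {x : Para m}

/-- The function `A(x_0, |x|²) + x B(x_0, |x|²)`: writing the odd part as `r B(x_0, r²)` removes the
division by `r` from the axial form. -/
def axialFn (A B : ℝ × ℝ → Cl m) (x : Para m) : Cl m :=
  A (axisCoord x) + vecPart x * B (axisCoord x)

theorem analyticAt_comp_axisCoord {G : ℝ × ℝ → Cl m} (hG : AnalyticAt ℝ G (axisCoord x)) :
    AnalyticAt ℝ (fun y : Para m => G (axisCoord y)) x :=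
  hG.comp_of_eq (analyticAt_axisCoord x) rfl

theorem analyticAt_axialFn (hA : AnalyticAt ℝ A (axisCoord x)) (hB : AnalyticAt ℝ B (axisCoord x)) :
    AnalyticAt ℝ (axialFn A B) x :=
  (analyticAt_comp_axisCoord hA).add (analyticAt_vecPart_mul (analyticAt_comp_axisCoord hB))

theorem dirDeriv_comp_axisCoord {G : ℝ × ℝ → Cl m} (hG : DifferentiableAt ℝ G (axisCoord x))
    (e : Para m) :
    dirDeriv e (fun y => G (axisCoord y)) x =
      fderiv ℝ G (axisCoord x) (dirDeriv e axisCoord x) := by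
  have h : HasFDerivAt (fun y => G (axisCoord y)) _ x :=
    hG.hasFDerivAt.comp x (analyticAt_axisCoord x).differentiableAt.hasFDerivAt
  rw [dirDeriv, h.fderiv]
  rfl

theorem dirDeriv_comp_axisCoord_succ {G : ℝ × ℝ → Cl m} (hG : DifferentiableAt ℝ G (axisCoord x))
    (j : Fin m) :
    dirDeriv (unitVec j.succ) (fun y => G (axisCoord y)) x =
      (2 * x j.succ) • ∂ₛ G (axisCoord x) := by
  rw [dirDeriv_comp_axisCoord hG, dirDeriv_axisCoord_succ, dirDeriv, ← map_smul]
  simp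

theorem dirDeriv_axialFn (hA : DifferentiableAt ℝ A (axisCoord x))
    (hB : DifferentiableAt ℝ B (axisCoord x)) (e : Para m) :
    dirDeriv e (axialFn A B) x =
      dirDeriv e (fun y => A (axisCoord y)) x
        + (vecPart x * dirDeriv e (fun y => B (axisCoord y)) x + vecPart e * B (axisCoord x)) := by
  have hN := (analyticAt_axisCoord x).differentiableAt
  have hA' : DifferentiableAt ℝ (fun y : Para m => A (axisCoord y)) x := hA.comp x hN
  have hB' : DifferentiableAt ℝ (fun y : Para m => B (axisCoord y)) x := hB.comp x hN
  have hXB : DifferentiableAt ℝ (fun y : Para m => vecPart y * B (axisCoord y)) x :=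
    ((mulL m).hasFDerivAt_of_bilinear (vecPartL m).hasFDerivAt hB'.hasFDerivAt).differentiableAt
  rw [← dirDeriv_vecPart_mul hB']
  exact dirDeriv_add hA' hXB e

theorem dirDeriv_axialFn_zero (hA : DifferentiableAt ℝ A (axisCoord x))
    (hB : DifferentiableAt ℝ B (axisCoord x)) :
    dirDeriv (unitVec 0) (axialFn A B) x = axialFn (∂ᵤ A) (∂ᵤ B) x := by
  rw [dirDeriv_axialFn hA hB, dirDeriv_comp_axisCoord hA, dirDeriv_comp_axisCoord hB,
    dirDeriv_axisCoord_zero, vecPart_unitVec_zero, zero_mul, add_zero]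
  rfl

theorem dirDeriv_axialFn_succ (hA : DifferentiableAt ℝ A (axisCoord x))
    (hB : DifferentiableAt ℝ B (axisCoord x)) (j : Fin m) :
    dirDeriv (unitVec j.succ) (axialFn A B) x =
      (2 * x j.succ) • axialFn (∂ₛ A) (∂ₛ B) x + gen j * B (axisCoord x) := by
  rw [dirDeriv_axialFn hA hB, dirDeriv_comp_axisCoord_succ hA, dirDeriv_comp_axisCoord_succ hB,
    vecPart_unitVec_succ]
  simp only [axialFn, smul_add, mul_smul_comm, add_assoc]

theorem cauchyRiemann_axialFn (hA : DifferentiableAt ℝ A (axisCoord x))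
    (hB : DifferentiableAt ℝ B (axisCoord x)) :
    dirDeriv (unitVec 0) (axialFn A B) x
        + ∑ j : Fin m, gen j * dirDeriv (unitVec j.succ) (axialFn A B) x =
      (∂ᵤ A (axisCoord x) - (2 * (axisCoord x).2) • ∂ₛ B (axisCoord x) - (m : ℝ) • B (axisCoord x))
        + vecPart x * (∂ᵤ B (axisCoord x) + (2 : ℝ) • ∂ₛ A (axisCoord x)) := by
  simp only [dirDeriv_axialFn_zero hA hB, dirDeriv_axialFn_succ hA hB, mul_add, mul_smul_comm,
    Finset.sum_add_distrib, sum_gen_mul_gen_mul, mul_smul, ← Finset.smul_sum, sum_smul_gen_mul]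
  simp only [axialFn, mul_add, vecPart_mul_vecPart_mul]
  module

theorem dirDeriv_dirDeriv_axialFn_zero (hA : AnalyticAt ℝ A (axisCoord x))
    (hB : AnalyticAt ℝ B (axisCoord x)) :
    dirDeriv (unitVec 0) (dirDeriv (unitVec 0) (axialFn A B)) x =
      axialFn (∂ᵤ (∂ᵤ A)) (∂ᵤ (∂ᵤ B)) x := by
  have hcont := (analyticAt_axisCoord x).continuousAt
  have h : dirDeriv (unitVec 0) (axialFn A B) =ᶠ[𝓝 x] axialFn (∂ᵤ A) (∂ᵤ B) := by
    filter_upwards [hcont.eventually hA.eventually_analyticAt,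
      hcont.eventually hB.eventually_analyticAt] with y hA hB
    exact dirDeriv_axialFn_zero hA.differentiableAt hB.differentiableAt
  rw [(dirDeriv_congr h _).eq_of_nhds,
    dirDeriv_axialFn_zero (differentiableAt_dirDeriv hA _) (differentiableAt_dirDeriv hB _)]

theorem dirDeriv_dirDeriv_axialFn_succ (hA : AnalyticAt ℝ A (axisCoord x))
    (hB : AnalyticAt ℝ B (axisCoord x)) (j : Fin m) :
    dirDeriv (unitVec j.succ) (dirDeriv (unitVec j.succ) (axialFn A B)) x =
      (2 : ℝ) • axialFn (∂ₛ A) (∂ₛ B) x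
        + (4 * x j.succ ^ 2) • axialFn (∂ₛ (∂ₛ A)) (∂ₛ (∂ₛ B)) x
        + (4 : ℝ) • x j.succ • (gen j * ∂ₛ B (axisCoord x)) := by
  have hcont := (analyticAt_axisCoord x).continuousAt
  have h : dirDeriv (unitVec j.succ) (axialFn A B) =ᶠ[𝓝 x]
      fun y => (2 * y j.succ) • axialFn (∂ₛ A) (∂ₛ B) y + gen j * B (axisCoord y) := by
    filter_upwards [hcont.eventually hA.eventually_analyticAt,
      hcont.eventually hB.eventually_analyticAt] with y hA hB
    exact dirDeriv_axialFn_succ hA.differentiableAt hB.differentiableAt j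
  have hcoord := (analyticAt_coord j.succ x).differentiableAt
  have hc : dirDeriv (unitVec j.succ) (fun y : Para m => 2 * y j.succ) x = 2 := by
    simpa [dirDeriv_coord] using dirDeriv_const_smul 2 hcoord (unitVec j.succ)
  have hs := (analyticAt_axialFn (analyticAt_dirDeriv hA (0, 1))
    (analyticAt_dirDeriv hB (0, 1))).differentiableAt
  have hB' := (analyticAt_comp_axisCoord hB).differentiableAt
  have hgB : DifferentiableAt ℝ (fun y => gen j * B (axisCoord y)) x :=
    (mulL m (gen j)).differentiableAt.comp x hB'
  have hdgB : dirDeriv (unitVec j.succ) (fun y => gen j * B (axisCoord y)) x = _ :=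
    dirDeriv_clm (mulL m (gen j)) hB' _
  rw [(dirDeriv_congr h _).eq_of_nhds,
    dirDeriv_add ((hcoord.const_mul 2).fun_smul hs) hgB,
    dirDeriv_smul (hcoord.const_mul 2) hs, hc, hdgB,
    dirDeriv_comp_axisCoord_succ hB.differentiableAt j,
    dirDeriv_axialFn_succ (differentiableAt_dirDeriv hA _) (differentiableAt_dirDeriv hB _),
    map_smul]
  change _ • (_ • _ + _) + _ + _ • (gen j * ∂ₛ B (axisCoord x)) = _
  module

theorem laplacian_axialFn (hA : AnalyticAt ℝ A (axisCoord x)) (hB : AnalyticAt ℝ B (axisCoord x)) :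
    Laplacian.laplacian (axialFn A B) x =
      axialFn (∂ᵤ (∂ᵤ A)) (∂ᵤ (∂ᵤ B)) x
        + (4 * (axisCoord x).2) • axialFn (∂ₛ (∂ₛ A)) (∂ₛ (∂ₛ B)) x
        + (2 * m : ℝ) • axialFn (∂ₛ A) (∂ₛ B) x
        + (4 : ℝ) • (vecPart x * ∂ₛ B (axisCoord x)) := by
  simp only [laplacian_eq_sum_dirDeriv (analyticAt_axialFn hA hB),
    dirDeriv_dirDeriv_axialFn_zero hA hB, dirDeriv_dirDeriv_axialFn_succ hA hB,
    Finset.sum_add_distrib, Finset.sum_const, Finset.card_univ, Fintype.card_fin,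
    ← Finset.smul_sum, ← Finset.sum_smul, sum_smul_gen_mul, ← Finset.mul_sum,
    ← Nat.cast_smul_eq_nsmul ℝ, axisCoord]
  module

theorem VekuaAt.cauchyRiemann_axialFn (h : VekuaAt m A B (axisCoord x)) :
    dirDeriv (unitVec 0) (axialFn A B) x
      + ∑ j : Fin m, gen j * dirDeriv (unitVec j.succ) (axialFn A B) x = 0 := by
  obtain ⟨hu, hs⟩ := h.2.2.self_of_nhds
  rw [FueterGCK.cauchyRiemann_axialFn h.1.differentiableAt h.2.1.differentiableAt, hu, hs,
    neg_smul, neg_add_cancel, mul_zero]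
  module

theorem VekuaAt.laplacian_axialFn {μ : ℝ} (h : VekuaAt μ A B (axisCoord x)) :
    Laplacian.laplacian (axialFn A B) x = (2 * m - 2 * μ) • axialFn (∂ₛ A) (∂ₛ B) x := by
  rw [FueterGCK.laplacian_axialFn h.1 h.2.1]
  simp only [axialFn, h.du_du_fst, h.du_du_snd, mul_sub, mul_smul_comm]
  module

end AxialFn

/-! ### Axial domains -/

section Domains

variable {m : ℕ} {D : Set ℂ} {x : Para m}

theorem rad_para_zero (u : ℝ) : rad (para u 0 : Para m) = 0 := by simp [rad, para]

theorem rad_para {w : Fin m → ℝ} (hw : ∑ j, w j ^ 2 = 1) (u v : ℝ) :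
    rad (para u (v • w)) = |v| := by
  simp only [rad, para, Fin.cons_succ, Pi.smul_apply, smul_eq_mul, mul_pow, ← Finset.mul_sum, hw,
    mul_one, Real.sqrt_sq_eq_abs]

theorem coord_eq_zero_of_rad_eq_zero (h : rad x = 0) (j : Fin m) : x j.succ = 0 := by
  have hsum : ∑ j : Fin m, x j.succ ^ 2 = 0 := by
    rw [← zero_pow two_ne_zero, ← h, rad_sq, axisCoord]
  rw [Finset.sum_eq_zero_iff_of_nonneg fun _ _ => sq_nonneg _] at hsum
  exact (pow_eq_zero_iff two_ne_zero).1 (hsum j (Finset.mem_univ j))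

theorem vecPart_eq_zero_of_rad_eq_zero (h : rad x = 0) : vecPart x = 0 := by
  simp [vecPart, vec_eq_sum, coord_eq_zero_of_rad_eq_zero h]

theorem axisCoord_eq (x : Para m) : axisCoord x = (x 0, rad x ^ 2) :=
  Prod.ext rfl (rad_sq x).symm

theorem axialFn_of_rad_eq_zero (A B : ℝ × ℝ → Cl m) (h : rad x = 0) :
    axialFn A B x = A (x 0, 0) := by
  rw [axialFn, vecPart_eq_zero_of_rad_eq_zero h, zero_mul, add_zero, axisCoord_eq, h,
    zero_pow two_ne_zero]

theorem exists_polar (hm : 0 < m) (x : Para m) :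
    ∃ w : Fin m → ℝ, ∑ j, w j ^ 2 = 1 ∧ x = para (x 0) (rad x • w) := by
  by_cases h : rad x = 0
  · refine ⟨Pi.single ⟨0, hm⟩ 1, by simp [Pi.single_apply], ?_⟩
    ext i
    refine Fin.cases rfl (fun j => ?_) i
    simp [para, h, coord_eq_zero_of_rad_eq_zero h]
  · refine ⟨fun j => (rad x)⁻¹ * x j.succ, ?_, ?_⟩
    · have hsum : ∑ j : Fin m, x j.succ ^ 2 = rad x ^ 2 := (rad_sq x).symm
      simp only [mul_pow, ← Finset.mul_sum, hsum]
      field_simp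
    · ext i
      refine Fin.cases rfl (fun j => ?_) i
      simp [para, h]

theorem continuous_mk_rad : Continuous fun x : Para m => (⟨x 0, rad x⟩ : ℂ) := by
  have hrad : Continuous (rad : Para m → ℝ) := by
    unfold rad
    fun_prop
  exact Complex.equivRealProdCLM.symm.continuous.comp
    ((EuclideanSpace.proj 0 : Para m →L[ℝ] ℝ).continuous.prodMk hrad)

theorem isOpen_axialDomain (hD : IsOpen D) : IsOpen (axialDomain m D) :=
  hD.preimage continuous_mk_rad

theorem isOpen_realTrace (hD : IsOpen D) : IsOpen (realTrace D) :=
  hD.preimage Complex.continuous_ofReal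

theorem para_zero_mem {x₀ : ℝ} (h : x₀ ∈ realTrace D) :
    (para x₀ 0 : Para m) ∈ axialDomain m D := by
  change (⟨x₀, rad (para x₀ 0 : Para m)⟩ : ℂ) ∈ D
  rw [rad_para_zero]
  exact h

theorem mk_abs_im_mem (hD : IsIntrinsicDomain D) {z : ℂ} (hz : z ∈ D) :
    (⟨z.re, |z.im|⟩ : ℂ) ∈ D := by
  rcases abs_choice z.im with h | h <;> rw [h]
  exacts [hz, hD.2.2 z hz]

theorem para_smul_mem (hD : IsIntrinsicDomain D) {z : ℂ} (hz : z ∈ D) {w : Fin m → ℝ}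
    (hw : ∑ j, w j ^ 2 = 1) : para z.re (z.im • w) ∈ axialDomain m D := by
  change (⟨z.re, rad (para z.re (z.im • w))⟩ : ℂ) ∈ D
  rw [rad_para hw]
  exact mk_abs_im_mem hD hz

theorem realTrace_nonempty (hD : IsIntrinsicDomain D) : (realTrace D).Nonempty := by
  obtain ⟨z, hz⟩ := hD.2.1.nonempty
  have hconn : IsPreconnected (Complex.im '' D) :=
    hD.2.1.isPreconnected.image _ Complex.continuous_im.continuousOn
  have hpos : |z.im| ∈ Complex.im '' D := ⟨_, mk_abs_im_mem hD hz, rfl⟩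
  have hneg : -|z.im| ∈ Complex.im '' D := ⟨_, hD.2.2 _ (mk_abs_im_mem hD hz), rfl⟩
  obtain ⟨y, hy, hy0⟩ := hconn.Icc_subset hneg hpos ⟨neg_nonpos.2 (abs_nonneg _), abs_nonneg _⟩
  refine ⟨y.re, ?_⟩
  change (y.re : ℂ) ∈ D
  rwa [Complex.conj_eq_iff_re.1 (Complex.conj_eq_iff_im.2 hy0)]

/-- The slice `ζ ↦ Re ζ + (Im ζ) w` as a continuous linear map. -/
def sliceL (w : Fin m → ℝ) : ℂ →L[ℝ] Para m :=
  Complex.reCLM.smulRight (para 1 0) + Complex.imCLM.smulRight (para 0 w)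

theorem sliceL_apply (w : Fin m → ℝ) (ζ : ℂ) : sliceL w ζ = para ζ.re (ζ.im • w) := by
  ext i
  refine Fin.cases ?_ (fun j => ?_) i <;> simp [sliceL, para]

theorem eqOn_axialDomain_of_eventuallyEq (hm : 0 < m) (hD : IsIntrinsicDomain D)
    {F G : Para m → Cl m} (hF : AnalyticOnNhd ℝ F (axialDomain m D))
    (hG : AnalyticOnNhd ℝ G (axialDomain m D)) {x₀ : ℝ} (hx₀ : x₀ ∈ realTrace D)
    (h : F =ᶠ[𝓝 (para x₀ 0)] G) : Set.EqOn F G (axialDomain m D) := by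
  intro x hx
  obtain ⟨w, hw, hxw⟩ := exists_polar hm x
  have hslice {H : Para m → Cl m} (hH : AnalyticOnNhd ℝ H (axialDomain m D)) :
      AnalyticOnNhd ℝ (fun ζ : ℂ => H (sliceL w ζ)) D := fun ζ hζ =>
    (hH _ (para_smul_mem hD hζ hw)).comp_of_eq ((sliceL w).analyticAt ζ) (sliceL_apply w ζ)
  have hev : (fun ζ : ℂ => F (sliceL w ζ)) =ᶠ[𝓝 (x₀ : ℂ)] fun ζ => G (sliceL w ζ) :=
    h.comp_tendsto ((sliceL w).continuous.tendsto' _ _ (by simp [sliceL_apply]))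
  have heq := (hslice hF).eqOn_of_preconnected_of_eventuallyEq (hslice hG) hD.2.1.isPreconnected
    (show (x₀ : ℂ) ∈ D from hx₀) hev (show (⟨x 0, rad x⟩ : ℂ) ∈ D from hx)
  simp only [sliceL_apply] at heq
  rwa [← hxw] at heq

end Domains

/-! ### The Fueter–Sce theorem for functions of axial type -/

section FueterSce

variable {m : ℕ} {D : Set ℂ} {A B : ℝ × ℝ → Cl m} {F : Para m → Cl m} {μ : ℝ}

theorem vekuaAt_axisCoord (h : ∀ z ∈ D, VekuaAt μ A B (z.re, z.im ^ 2)) {x : Para m}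
    (hx : x ∈ axialDomain m D) : VekuaAt μ A B (axisCoord x) := by
  rw [axisCoord_eq]
  exact h _ hx

theorem analyticOnNhd_of_vekuaAt (hD : IsOpen D) (h : ∀ z ∈ D, VekuaAt μ A B (z.re, z.im ^ 2))
    (hF : Set.EqOn F (axialFn A B) (axialDomain m D)) :
    AnalyticOnNhd ℝ F (axialDomain m D) := fun _ hx =>
  (analyticAt_axialFn (vekuaAt_axisCoord h hx).1 (vekuaAt_axisCoord h hx).2.1).congr
    (hF.eventuallyEq_of_mem ((isOpen_axialDomain hD).mem_nhds hx)).symm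

theorem isAxialMonogenic_of_vekuaAt (hD : IsOpen D)
    (h : ∀ z ∈ D, VekuaAt m A B (z.re, z.im ^ 2))
    (hF : Set.EqOn F (axialFn A B) (axialDomain m D)) : IsAxialMonogenic D F := by
  have han := analyticOnNhd_of_vekuaAt hD h hF
  have hsq (z : ℂ) : AnalyticAt ℝ (fun z : ℂ => (z.re, z.im ^ 2)) z :=
    (Complex.reCLM.analyticAt z).prod ((Complex.imCLM.analyticAt z).fun_pow 2)
  refine ⟨han, ⟨fun x hx => (han x hx).contDiffAt.contDiffWithinAt, fun x hx => ?_⟩,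
    fun z => A (z.re, z.im ^ 2), fun z => z.im • B (z.re, z.im ^ 2),
    fun z hz => (h z hz).1.comp_of_eq (hsq z) rfl,
    fun z hz => (Complex.imCLM.analyticAt z).fun_smul ((h z hz).2.1.comp_of_eq (hsq z) rfl),
    fun z _ => by simp, fun z _ => by simp, fun x hx => ?_⟩
  · rw [(hF.eventuallyEq_of_mem ((isOpen_axialDomain hD).mem_nhds hx)).fderiv_eq]
    exact (vekuaAt_axisCoord h hx).cauchyRiemann_axialFn
  · rw [hF hx]
    by_cases h0 : rad x = 0
    · simp [axialFn_of_rad_eq_zero A B h0, h0]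
    · rw [axialFn, axisCoord_eq, smul_mul_assoc, mul_smul_comm, smul_smul, inv_mul_cancel₀ h0,
        one_smul]

theorem laplacePow_succ (k : ℕ) (F : Para m → Cl m) :
    laplacePow (k + 1) F = Laplacian.laplacian (laplacePow k F) :=
  Function.iterate_succ_apply' _ k F

theorem eqOn_laplacePow_of_vekuaAt (hD : IsOpen D) (h : ∀ z ∈ D, VekuaAt μ A B (z.re, z.im ^ 2))
    (hF : Set.EqOn F (axialFn A B) (axialDomain m D)) (k : ℕ) :
    Set.EqOn (laplacePow k F)
      (fun x => (∏ i ∈ Finset.range k, (2 * m - 2 * (μ + 2 * i) : ℝ)) •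
        axialFn (∂ₛ^[k] A) (∂ₛ^[k] B) x) (axialDomain m D) := by
  induction k with
  | zero => simpa [laplacePow] using hF
  | succ k ih =>
    intro x hx
    have hk := (vekuaAt_axisCoord h hx).ds_iterate k
    have hev := ih.eventuallyEq_of_mem ((isOpen_axialDomain hD).mem_nhds hx)
    rw [laplacePow_succ, (InnerProductSpace.laplacian_congr_nhds hev).eq_of_nhds]
    set c : ℝ := ∏ i ∈ Finset.range k, (2 * m - 2 * (μ + 2 * i) : ℝ) with hc
    have hsmul : Laplacian.laplacian (c • axialFn (∂ₛ^[k] A) (∂ₛ^[k] B)) x = _ :=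
      InnerProductSpace.laplacian_smul c (analyticAt_axialFn hk.1 hk.2.1).contDiffAt
    refine hsmul.trans ?_
    simp only [hk.laplacian_axialFn, smul_smul, Finset.prod_range_succ, ← hc,
      Function.iterate_succ_apply']

theorem prod_laplacian_factors (n : ℕ) :
    ∏ i ∈ Finset.range n, (2 * ((2 * n + 1 : ℕ) : ℝ) - 2 * (1 + 2 * i)) =
      2 ^ n * ((2 * n).doubleFactorial : ℝ) := by
  have hfactor : ∀ i ∈ Finset.range n,
      2 * ((2 * n + 1 : ℕ) : ℝ) - 2 * (1 + 2 * ((n - 1 - i : ℕ) : ℝ)) = 4 * ((i + 1 : ℕ) : ℝ) := by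
    intro i hi
    have hi := Finset.mem_range.1 hi
    rw [Nat.sub_sub, Nat.cast_sub (by lia)]
    push_cast
    ring
  rw [← Finset.prod_range_reflect, Finset.prod_congr rfl hfactor, Finset.prod_mul_distrib,
    Finset.prod_const, Finset.card_range, ← Nat.cast_prod, Finset.prod_range_add_one_eq_factorial,
    Nat.doubleFactorial_two_mul, Nat.cast_mul, Nat.cast_pow, ← mul_assoc, Nat.cast_ofNat, ← mul_pow]
  norm_num

variable {n : ℕ} (hD : IsOpen D) (hm : m = 2 * n + 1)
  (h : ∀ z ∈ D, VekuaAt 1 A B (z.re, z.im ^ 2)) (hF : Set.EqOn F (axialFn A B) (axialDomain m D))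

include hD hm h hF

theorem eqOn_laplacePow_fueterSce :
    Set.EqOn (laplacePow n F)
      (fun x => (2 ^ n * ((2 * n).doubleFactorial : ℝ)) • axialFn (∂ₛ^[n] A) (∂ₛ^[n] B) x)
      (axialDomain m D) := by
  rw [← prod_laplacian_factors, ← hm]
  exact eqOn_laplacePow_of_vekuaAt hD h hF n

theorem isAxialMonogenic_laplacePow : IsAxialMonogenic D (laplacePow n F) := by
  set c : ℝ := 2 ^ n * (2 * n).doubleFactorial
  refine isAxialMonogenic_of_vekuaAt (A := fun q => c • ∂ₛ^[n] A q) (B := fun q => c • ∂ₛ^[n] B q)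
    hD (fun z hz => ?_) ((eqOn_laplacePow_fueterSce hD hm h hF).trans fun x _ => ?_)
  · have hμ : (m : ℝ) = 1 + 2 * n := by
      rw [hm]
      push_cast
      ring
    rw [hμ]
    exact ((h z hz).ds_iterate n).clm (c • ContinuousLinearMap.id ℝ (Cl m))
  · simp only [axialFn, smul_add, mul_smul_comm, c]

theorem laplacePow_para_zero {x₀ : ℝ} (hx₀ : x₀ ∈ realTrace D) :
    laplacePow n F (para x₀ 0) = (2 ^ n * ((2 * n).doubleFactorial : ℝ)) • ∂ₛ^[n] A (x₀, 0) := by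
  rw [eqOn_laplacePow_fueterSce hD hm h hF (para_zero_mem hx₀)]
  beta_reduce
  rw [axialFn_of_rad_eq_zero _ _ (rad_para_zero x₀)]
  rfl

end FueterSce

/-! ### The system of axially monogenic functions -/

theorem hasSum_even_of_odd_eq_zero {M : Type*} [AddCommMonoid M] [TopologicalSpace M] {a : ℕ → M}
    {s : M} (h : HasSum a s) (hodd : ∀ k, a (2 * k + 1) = 0) : HasSum (fun k => a (2 * k)) s := by
  have hinj : Function.Injective fun k : ℕ => 2 * k := mul_right_injective₀ two_ne_zero
  refine (hinj.hasSum_iff fun k hk => ?_).2 h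
  obtain ⟨j, rfl | rfl⟩ := k.even_or_odd'
  · exact absurd ⟨j, rfl⟩ hk
  · exact hodd j

theorem hasSum_odd_of_even_eq_zero {M : Type*} [AddCommMonoid M] [TopologicalSpace M] {a : ℕ → M}
    {s : M} (h : HasSum a s) (heven : ∀ k, a (2 * k) = 0) : HasSum (fun k => a (2 * k + 1)) s := by
  have hinj : Function.Injective fun k : ℕ => 2 * k + 1 :=
    (add_left_injective 1).comp (mul_right_injective₀ two_ne_zero)
  refine (hinj.hasSum_iff fun k hk => ?_).2 h
  obtain ⟨j, rfl | rfl⟩ := k.even_or_odd'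
  · exact heven j
  · exact absurd ⟨j, rfl⟩ hk

/-- The system `v ∂_u A = v ∂_v B + (μ - 1) B`, `∂_v A = -∂_u B` for real analytic functions of
`z = u + iv ∈ D` with `B = 0` on the real axis. For `μ = m` it says that the function
`A(x_0, |x|) + (x / |x|) B(x_0, |x|)` of `ℝ^{m+1}` is monogenic. -/
structure AxialSystem {E : Type*} [NormedAddCommGroup E] [NormedSpace ℝ E] (μ : ℝ) (D : Set ℂ)
    (A B : ℂ → E) : Prop where
  analytic_fst : AnalyticOnNhd ℝ A D
  analytic_snd : AnalyticOnNhd ℝ B D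
  im_smul_eq : Set.EqOn (fun z => z.im • dirDeriv 1 A z)
    (fun z => z.im • dirDeriv Complex.I B z + (μ - 1) • B z) D
  dirDeriv_I_eq : Set.EqOn (dirDeriv Complex.I A) (fun z => -dirDeriv 1 B z) D
  snd_axis : ∀ x ∈ realTrace D, B (x : ℂ) = 0

section AxialSystem

variable {E : Type*} [NormedAddCommGroup E] [NormedSpace ℝ E] {D : Set ℂ} {μ : ℝ}

theorem dirDeriv_im_smul {G : ℂ → E} {z : ℂ} (hG : DifferentiableAt ℝ G z) (e : ℂ) :
    dirDeriv e (fun ζ => ζ.im • G ζ) z = z.im • dirDeriv e G z + e.im • G z := by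
  have him : HasFDerivAt (fun ζ : ℂ => ζ.im) Complex.imCLM z := Complex.imCLM.hasFDerivAt
  have he : dirDeriv e (fun ζ : ℂ => ζ.im) z = e.im := by rw [dirDeriv, him.fderiv]; rfl
  rw [dirDeriv_smul him.differentiableAt hG, he]

theorem hasDerivAt_comp_ofReal {G : ℂ → E} {x : ℝ} (hG : DifferentiableAt ℝ G (x : ℂ)) :
    HasDerivAt (fun t : ℝ => G (t : ℂ)) (dirDeriv 1 G (x : ℂ)) x := by
  have h : HasDerivAt (fun t : ℝ => (t : ℂ)) 1 x := Complex.ofRealCLM.hasDerivAt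
  exact hG.hasFDerivAt.comp_hasDerivAt x h

variable [CompleteSpace E]

theorem dirDeriv_I_iterate_im_smul {G : ℂ → E} {z : ℂ} (hG : AnalyticAt ℝ G z) (k : ℕ) :
    (dirDeriv Complex.I)^[k + 1] (fun ζ => ζ.im • G ζ) z =
      ((k : ℝ) + 1) • (dirDeriv Complex.I)^[k] G z +
        z.im • (dirDeriv Complex.I)^[k + 1] G z := by
  induction k generalizing z with
  | zero => simp [dirDeriv_im_smul hG.differentiableAt, add_comm]
  | succ k ih =>
    have hk := (analyticAt_dirDeriv_iterate hG Complex.I k).differentiableAt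
    have hk' := (analyticAt_dirDeriv_iterate hG Complex.I (k + 1)).differentiableAt
    have him : DifferentiableAt ℝ (fun ζ : ℂ => ζ.im) z := Complex.imCLM.differentiableAt
    have hev : (dirDeriv Complex.I)^[k + 1] (fun ζ => ζ.im • G ζ) =ᶠ[𝓝 z] fun ζ =>
        ((k : ℝ) + 1) • (dirDeriv Complex.I)^[k] G ζ +
          ζ.im • (dirDeriv Complex.I)^[k + 1] G ζ := by
      filter_upwards [hG.eventually_analyticAt] with ζ hζ using ih hζ
    rw [Function.iterate_succ_apply', (dirDeriv_congr hev _).eq_of_nhds,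
      dirDeriv_add (hk.fun_const_smul _) (him.fun_smul hk'), dirDeriv_im_smul hk',
      dirDeriv_const_smul _ hk, ← Function.iterate_succ_apply' (dirDeriv Complex.I) k,
      ← Function.iterate_succ_apply' (dirDeriv Complex.I) (k + 1), Complex.I_im]
    push_cast
    module

theorem iteratedDeriv_eq_dirDeriv_one {G : ℂ → E} (hD : IsOpen D) (hG : AnalyticOnNhd ℝ G D)
    {g : ℝ → E} (hg : ∀ x ∈ realTrace D, g x = G x) (k : ℕ) :
    ∀ x ∈ realTrace D, iteratedDeriv k g x = (dirDeriv 1)^[k] G (x : ℂ) := by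
  induction k with
  | zero => simpa only [iteratedDeriv_zero, Function.iterate_zero, id_eq] using hg
  | succ k ih =>
    intro x hx
    have hev : iteratedDeriv k g =ᶠ[𝓝 x] fun t : ℝ => (dirDeriv 1)^[k] G (t : ℂ) := by
      filter_upwards [(isOpen_realTrace hD).mem_nhds hx] with y hy using ih y hy
    rw [iteratedDeriv_succ, Function.iterate_succ_apply', hev.deriv_eq]
    exact (hasDerivAt_comp_ofReal
      (analyticAt_dirDeriv_iterate (hG _ hx) 1 k).differentiableAt).deriv

namespace AxialSystem

variable {A B : ℂ → E}

theorem dirDeriv_one (h : AxialSystem μ D A B) (hD : IsOpen D) :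
    AxialSystem μ D (dirDeriv 1 A) (dirDeriv 1 B) where
  analytic_fst z hz := analyticAt_dirDeriv (h.analytic_fst z hz) _
  analytic_snd z hz := analyticAt_dirDeriv (h.analytic_snd z hz) _
  im_smul_eq z hz := by
    have hA := differentiableAt_dirDeriv (h.analytic_fst z hz) 1
    have hB := differentiableAt_dirDeriv (h.analytic_snd z hz) Complex.I
    have hB₀ := (h.analytic_snd z hz).differentiableAt
    have him : DifferentiableAt ℝ (fun ζ : ℂ => ζ.im) z := Complex.imCLM.differentiableAt
    have key := (dirDeriv_congr (h.im_smul_eq.eventuallyEq_of_mem (hD.mem_nhds hz)) 1).eq_of_nhds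
    rw [dirDeriv_im_smul hA, dirDeriv_add (him.fun_smul hB) (hB₀.fun_const_smul _),
      dirDeriv_im_smul hB, dirDeriv_const_smul _ hB₀, dirDeriv_comm (h.analytic_snd z hz)] at key
    simpa only [Complex.one_im, zero_smul, add_zero] using key
  dirDeriv_I_eq z hz := by
    have hB := differentiableAt_dirDeriv (h.analytic_snd z hz) 1
    have key :=
      (dirDeriv_congr (h.dirDeriv_I_eq.eventuallyEq_of_mem (hD.mem_nhds hz)) 1).eq_of_nhds
    rw [dirDeriv_comm (h.analytic_fst z hz)] at key
    exact key.trans (dirDeriv_clm (-ContinuousLinearMap.id ℝ E) hB 1)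
  snd_axis x hx := by
    have hzero : (fun t : ℝ => B (t : ℂ)) =ᶠ[𝓝 x] fun _ => 0 := by
      filter_upwards [(isOpen_realTrace hD).mem_nhds hx] with y hy using h.snd_axis y hy
    exact (hasDerivAt_comp_ofReal (h.analytic_snd _ hx).differentiableAt).unique
      ((hasDerivAt_const x (0 : E)).congr_of_eventuallyEq hzero)

theorem dirDeriv_I_iterate_fst (h : AxialSystem μ D A B) (hD : IsOpen D) (k : ℕ) {x : ℝ}
    (hx : x ∈ realTrace D) :
    (dirDeriv Complex.I)^[k + 1] A (x : ℂ) =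
      -(dirDeriv Complex.I)^[k] (dirDeriv 1 B) (x : ℂ) := by
  have hev := h.dirDeriv_I_eq.eventuallyEq_of_mem (hD.mem_nhds hx)
  rw [Function.iterate_succ_apply, (dirDeriv_iterate_congr hev Complex.I k).eq_of_nhds]
  exact dirDeriv_iterate_clm (-ContinuousLinearMap.id ℝ E)
    (analyticAt_dirDeriv (h.analytic_snd _ hx) 1) Complex.I k

theorem dirDeriv_I_iterate_snd (h : AxialSystem μ D A B) (hD : IsOpen D) (k : ℕ) {x : ℝ}
    (hx : x ∈ realTrace D) :
    ((k : ℝ) + μ) • (dirDeriv Complex.I)^[k + 1] B (x : ℂ) =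
      ((k : ℝ) + 1) • (dirDeriv Complex.I)^[k] (dirDeriv 1 A) (x : ℂ) := by
  have hA := analyticAt_dirDeriv (h.analytic_fst _ hx) 1
  have hB := analyticAt_dirDeriv (h.analytic_snd _ hx) Complex.I
  have hB₀ := h.analytic_snd _ hx
  have him : AnalyticAt ℝ (fun ζ : ℂ => ζ.im) (x : ℂ) := Complex.imCLM.analyticAt _
  have hsmul : (dirDeriv Complex.I)^[k + 1] (fun z => (μ - 1) • B z) (x : ℂ) =
      (μ - 1) • (dirDeriv Complex.I)^[k + 1] B (x : ℂ) :=
    dirDeriv_iterate_clm ((μ - 1) • ContinuousLinearMap.id ℝ E) hB₀ Complex.I (k + 1)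
  have key := (dirDeriv_iterate_congr (h.im_smul_eq.eventuallyEq_of_mem (hD.mem_nhds hx))
    Complex.I (k + 1)).eq_of_nhds
  rw [dirDeriv_I_iterate_im_smul hA,
    dirDeriv_iterate_add (him.fun_smul hB) (analyticAt_const.fun_smul hB₀),
    dirDeriv_I_iterate_im_smul hB, hsmul, ← Function.iterate_succ_apply] at key
  simp only [Complex.ofReal_im, zero_smul, add_zero] at key
  rw [key]
  module

end AxialSystem

/-- The Taylor coefficients in `v` of a solution `(A, B)` of the system, as multiples
`A = ∑ a_k v^k`, `B = ∑ b_k v^k` of the derivatives `∂_u^k A(u, 0)`. -/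
def axialCoeff (μ : ℝ) : ℕ → ℝ × ℝ
  | 0 => (1, 0)
  | k + 1 => (-(axialCoeff μ k).2 / (k + 1), (axialCoeff μ k).1 / (k + μ))

theorem AxialSystem.dirDeriv_I_iterate (hμ : 0 < μ) (hD : IsOpen D) (k : ℕ) {A B : ℂ → E}
    (h : AxialSystem μ D A B) {x : ℝ} (hx : x ∈ realTrace D) :
    (dirDeriv Complex.I)^[k] A (x : ℂ) =
        ((k.factorial : ℝ) * (axialCoeff μ k).1) • (dirDeriv 1)^[k] A (x : ℂ) ∧
      (dirDeriv Complex.I)^[k] B (x : ℂ) =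
        ((k.factorial : ℝ) * (axialCoeff μ k).2) • (dirDeriv 1)^[k] A (x : ℂ) := by
  induction k generalizing A B with
  | zero => simp [axialCoeff, h.snd_axis x hx]
  | succ k ih =>
    obtain ⟨ihA, ihB⟩ := ih (h.dirDeriv_one hD)
    have hk₁ : (k : ℝ) + 1 ≠ 0 := by positivity
    have hkμ : (k : ℝ) + μ ≠ 0 := by positivity
    have hfac : ((k + 1).factorial : ℝ) = (k + 1) * k.factorial := by
      rw [Nat.factorial_succ]
      push_cast
      rfl
    constructor
    · rw [h.dirDeriv_I_iterate_fst hD k hx, ihB, ← neg_smul, Function.iterate_succ_apply,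
        axialCoeff, hfac]
      congr 1
      field_simp
    · have hB := h.dirDeriv_I_iterate_snd hD k hx
      rw [ihA, smul_smul] at hB
      rw [← inv_smul_smul₀ hkμ ((dirDeriv Complex.I)^[k + 1] B (x : ℂ)), hB, smul_smul,
        Function.iterate_succ_apply, axialCoeff, hfac]
      congr 1
      field_simp

theorem axialCoeff_parity (μ : ℝ) (k : ℕ) :
    (axialCoeff μ (2 * k)).2 = 0 ∧ (axialCoeff μ (2 * k + 1)).1 = 0 := by
  induction k with
  | zero => simp [axialCoeff]
  | succ k ih =>
    have h : (axialCoeff μ (2 * (k + 1))).2 = 0 := by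
      rw [Nat.mul_succ, axialCoeff, ih.2, zero_div]
    exact ⟨h, by rw [axialCoeff, h, neg_zero, zero_div]⟩

theorem axialCoeff_bessel_snd (hμ : 0 < μ) {k : ℕ}
    (h : (axialCoeff μ (2 * k)).1 =
      Real.Gamma (μ / 2) / 2 ^ (2 * k) * besselCoeff (μ / 2 - 1) k) :
    (axialCoeff μ (2 * k + 1)).2 =
      Real.Gamma (μ / 2) / 2 ^ (2 * k) * besselCoeff (μ / 2) k * (1 / 2) := by
  have hk : (k : ℝ) + μ / 2 ≠ 0 := by positivity
  have hkμ : 2 * (k : ℝ) + μ ≠ 0 := by positivity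
  have hΓ : Real.Gamma ((k : ℝ) + μ / 2) ≠ 0 := (Real.Gamma_pos_of_pos (by positivity)).ne'
  have hshift : (k : ℝ) + (μ / 2 - 1) + 1 = k + μ / 2 := by ring
  rw [axialCoeff, h, besselCoeff, besselCoeff, Real.Gamma_add_one hk, hshift]
  push_cast
  field_simp [hΓ]

theorem axialCoeff_bessel_fst_succ (hμ : 0 < μ) {k : ℕ}
    (h : (axialCoeff μ (2 * k + 1)).2 =
      Real.Gamma (μ / 2) / 2 ^ (2 * k) * besselCoeff (μ / 2) k * (1 / 2)) :
    (axialCoeff μ (2 * (k + 1))).1 =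
      Real.Gamma (μ / 2) / 2 ^ (2 * (k + 1)) * besselCoeff (μ / 2 - 1) (k + 1) := by
  have hΓ : Real.Gamma ((k : ℝ) + μ / 2 + 1) ≠ 0 := (Real.Gamma_pos_of_pos (by positivity)).ne'
  have hshift : ((k : ℝ) + 1) + (μ / 2 - 1) + 1 = k + μ / 2 + 1 := by ring
  rw [Nat.mul_succ, axialCoeff, h, besselCoeff, besselCoeff, Nat.factorial_succ]
  push_cast
  rw [hshift, pow_add (2 : ℝ) _ 2, pow_succ (-1 : ℝ) k]
  field_simp [hΓ]
  ring

theorem axialCoeff_bessel (hμ : 0 < μ) (k : ℕ) :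
    (axialCoeff μ (2 * k)).1 = Real.Gamma (μ / 2) / 2 ^ (2 * k) * besselCoeff (μ / 2 - 1) k ∧
      (axialCoeff μ (2 * k + 1)).2 =
        Real.Gamma (μ / 2) / 2 ^ (2 * k) * besselCoeff (μ / 2) k * (1 / 2) := by
  suffices h : (axialCoeff μ (2 * k)).1 =
      Real.Gamma (μ / 2) / 2 ^ (2 * k) * besselCoeff (μ / 2 - 1) k from
    ⟨h, axialCoeff_bessel_snd hμ h⟩
  induction k with
  | zero =>
    have hΓ : Real.Gamma (μ / 2) ≠ 0 := (Real.Gamma_pos_of_pos (by positivity)).ne'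
    simp [axialCoeff, besselCoeff, hΓ]
  | succ k ih => exact axialCoeff_bessel_fst_succ hμ (axialCoeff_bessel_snd hμ ih)

theorem exists_hasSum_dirDeriv_I {G : ℂ → E} {x₀ : ℝ} (hG : AnalyticAt ℝ G (x₀ : ℂ)) :
    ∃ ρ : ℝ, 0 < ρ ∧ ∀ u v : ℝ, |u - x₀| < ρ → |v| < ρ →
      HasSum (fun k : ℕ => ((k.factorial : ℝ)⁻¹ * v ^ k) • (dirDeriv Complex.I)^[k] G (u : ℂ))
        (G ⟨u, v⟩) := by
  obtain ⟨p, r, hp⟩ := hG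
  obtain ⟨R, hR0, hR⟩ := ENNReal.lt_iff_exists_nnreal_btwn.1 hp.r_pos
  have hR0 : (0 : ℝ) < R / 2 := by
    have hR₀ : (0 : ℝ) < R := by exact_mod_cast hR0
    positivity
  refine ⟨R / 2, hR0, fun u v hu hv => ?_⟩
  set y : ℂ := ((u - x₀ : ℝ) : ℂ)
  have hy : ‖y‖ₑ < ENNReal.ofReal (R / 2) := by
    rwa [← ofReal_norm, ENNReal.ofReal_lt_ofReal_iff hR0, Complex.norm_real]
  have hvI : ‖v • Complex.I‖ₑ < ENNReal.ofReal (R / 2) := by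
    rwa [← ofReal_norm, ENNReal.ofReal_lt_ofReal_iff hR0, norm_smul, Complex.norm_I, mul_one]
  have hsum : ‖v • Complex.I‖ₑ + ‖y‖ₑ < r := by
    refine (ENNReal.add_lt_add hvI hy).trans ?_
    rwa [← ENNReal.ofReal_add hR0.le hR0.le, add_halves, ENNReal.ofReal_coe_nnreal]
  have hu_eq : (x₀ : ℂ) + y = u := by
    rw [← Complex.ofReal_add, add_sub_cancel]
  have hball := hp.changeOrigin (le_add_self.trans_lt hsum)
  rw [hu_eq] at hball
  have hmem : v • Complex.I ∈ Metric.eball (0 : ℂ) (r - ‖y‖ₑ) := by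
    rw [Metric.mem_eball, edist_zero_right]
    exact lt_tsub_iff_right.2 hsum
  have huv : (u : ℂ) + v • Complex.I = ⟨u, v⟩ := by apply Complex.ext <;> simp
  have hterm : ∀ k : ℕ, iteratedFDeriv ℝ k G (u : ℂ) (fun _ => v • Complex.I) =
      v ^ k • (dirDeriv Complex.I)^[k] G (u : ℂ) := fun k => by
    rw [(iteratedFDeriv ℝ k G (u : ℂ)).map_smul_univ (fun _ => v) fun _ => Complex.I,
      iteratedFDeriv_const_apply hball.analyticAt, Finset.prod_const, Finset.card_univ,
      Fintype.card_fin]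
  simpa only [hterm, smul_smul, huv] using hball.hasSum_iteratedFDeriv hmem

theorem AxialSystem.exists_hasSum {A B : ℂ → E} (h : AxialSystem μ D A B) (hμ : 0 < μ)
    (hD : IsOpen D) {x₀ : ℝ} (hx₀ : x₀ ∈ realTrace D) :
    ∃ ρ : ℝ, 0 < ρ ∧ ∀ u ∈ realTrace D, |u - x₀| < ρ → ∀ v : ℝ, |v| < ρ →
      HasSum (fun k => (v ^ (2 * k) * (axialCoeff μ (2 * k)).1) •
        (dirDeriv 1)^[2 * k] A (u : ℂ)) (A ⟨u, v⟩) ∧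
      HasSum (fun k => (v ^ (2 * k + 1) * (axialCoeff μ (2 * k + 1)).2) •
        (dirDeriv 1)^[2 * k + 1] A (u : ℂ)) (B ⟨u, v⟩) := by
  obtain ⟨ρ₁, hρ₁, hA⟩ := exists_hasSum_dirDeriv_I (h.analytic_fst _ hx₀)
  obtain ⟨ρ₂, hρ₂, hB⟩ := exists_hasSum_dirDeriv_I (h.analytic_snd _ hx₀)
  refine ⟨min ρ₁ ρ₂, lt_min hρ₁ hρ₂, fun u hu hux₀ v hv => ?_⟩
  have hA' := hA u v (hux₀.trans_le (min_le_left _ _)) (hv.trans_le (min_le_left _ _))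
  have hB' := hB u v (hux₀.trans_le (min_le_right _ _)) (hv.trans_le (min_le_right _ _))
  have hcoeff : ∀ (k : ℕ) (c : ℝ), (k.factorial : ℝ)⁻¹ * v ^ k * (k.factorial * c) = v ^ k * c := by
    intro k c
    have hfact : (k.factorial : ℝ) ≠ 0 := by exact_mod_cast k.factorial_ne_zero
    field_simp [hfact]
  have hiter := fun k => h.dirDeriv_I_iterate hμ hD k hu
  simp only [fun k => (hiter k).1, smul_smul, hcoeff] at hA'
  simp only [fun k => (hiter k).2, smul_smul, hcoeff] at hB'
  have hA_even := hasSum_even_of_odd_eq_zero hA' fun k => by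
    rw [(axialCoeff_parity μ k).2, mul_zero, zero_smul]
  have hB_odd := hasSum_odd_of_even_eq_zero hB' fun k => by
    rw [(axialCoeff_parity μ k).1, mul_zero, zero_smul]
  exact ⟨hA_even, hB_odd⟩

end AxialSystem

/-! ### The generalized CK-extension -/

section SqrtPt

variable {E : Type*} [NormedAddCommGroup E] [NormedSpace ℝ E] {G : ℂ → E} {z : ℂ}

/-- The point `u + i √s`, which takes functions of `u + iv` to functions of `(u, s)` with
`s = v²`. -/
def sqrtPt (q : ℝ × ℝ) : ℂ := ⟨q.1, √q.2⟩

theorem sqrtPt_mk_sq (hz : 0 < z.im) : sqrtPt (z.re, z.im ^ 2) = z :=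
  Complex.ext rfl (Real.sqrt_sq hz.le)

theorem hasFDerivAt_sqrtPt (hz : 0 < z.im) :
    HasFDerivAt sqrtPt (Complex.equivRealProdCLM.symm.toContinuousLinearMap.comp
      ((ContinuousLinearMap.fst ℝ ℝ ℝ).prod
        ((1 / (2 * z.im)) • ContinuousLinearMap.snd ℝ ℝ ℝ))) (z.re, z.im ^ 2) := by
  have hsqrt : HasFDerivAt (fun q : ℝ × ℝ => √q.2)
      ((1 / (2 * z.im)) • ContinuousLinearMap.snd ℝ ℝ ℝ) (z.re, z.im ^ 2) := by
    have h := Real.hasDerivAt_sqrt (pow_pos hz 2).ne'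
    rw [Real.sqrt_sq hz.le] at h
    exact h.comp_hasFDerivAt (z.re, z.im ^ 2) hasFDerivAt_snd
  exact Complex.equivRealProdCLM.symm.toContinuousLinearMap.hasFDerivAt.comp _
    (hasFDerivAt_fst.prodMk hsqrt)

theorem hasFDerivAt_comp_sqrtPt (hz : 0 < z.im) (hG : DifferentiableAt ℝ G z) :
    HasFDerivAt (fun q => G (sqrtPt q)) ((fderiv ℝ G z).comp
      (Complex.equivRealProdCLM.symm.toContinuousLinearMap.comp
        ((ContinuousLinearMap.fst ℝ ℝ ℝ).prod
          ((1 / (2 * z.im)) • ContinuousLinearMap.snd ℝ ℝ ℝ)))) (z.re, z.im ^ 2) := by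
  refine HasFDerivAt.comp _ ?_ (hasFDerivAt_sqrtPt hz)
  rw [sqrtPt_mk_sq hz]
  exact hG.hasFDerivAt

theorem dirDeriv_fst_comp_sqrtPt (hz : 0 < z.im) (hG : DifferentiableAt ℝ G z) :
    ∂ᵤ (fun q => G (sqrtPt q)) (z.re, z.im ^ 2) = dirDeriv 1 G z := by
  rw [dirDeriv, (hasFDerivAt_comp_sqrtPt hz hG).fderiv, dirDeriv, ContinuousLinearMap.comp_apply]
  congr 1
  apply Complex.ext <;> simp

theorem dirDeriv_snd_comp_sqrtPt (hz : 0 < z.im) (hG : DifferentiableAt ℝ G z) :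
    ∂ₛ (fun q => G (sqrtPt q)) (z.re, z.im ^ 2) = (1 / (2 * z.im)) • dirDeriv Complex.I G z := by
  rw [dirDeriv, (hasFDerivAt_comp_sqrtPt hz hG).fderiv, dirDeriv, ContinuousLinearMap.comp_apply,
    ← map_smul]
  congr 1
  apply Complex.ext <;> simp

end SqrtPt

section GCKExtension

variable {m : ℕ} {D : Set ℂ} {A B : ℂ → Cl m} {F G : Para m → Cl m} {g : ℝ → Cl m} {x₀ : ℝ}

theorem eq_zero_of_vec_mul {P Q : Cl m} {v : Fin m → ℝ} (hv : ∑ j, v j ^ 2 ≠ 0)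
    (hadd : P + vec v * Q = 0) (hsub : P + vec (-v) * Q = 0) : P = 0 ∧ Q = 0 := by
  have hneg : vec (-v) = -vec v := map_neg _ v
  have hP : P = 0 := by
    have h : (2 : ℝ) • P = (P + vec v * Q) + (P + vec (-v) * Q) := by
      rw [hneg, neg_mul]
      module
    rw [hadd, hsub, add_zero] at h
    exact (smul_eq_zero.1 h).resolve_left two_ne_zero
  rw [hP, zero_add] at hadd
  have hQ : (-∑ j, v j ^ 2) • Q = 0 := by
    rw [Algebra.smul_def, ← vec_mul_vec, mul_assoc, hadd, mul_zero]
  exact ⟨hP, (smul_eq_zero.1 hQ).resolve_left (neg_ne_zero.2 hv)⟩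

theorem vekua_of_isMonogenicOn_axialFn (hm : 0 < m) (hD : IsIntrinsicDomain D)
    {A B : ℝ × ℝ → Cl m} (hF : IsMonogenicOn (axialDomain m D) F)
    (hFAB : Set.EqOn F (axialFn A B) (axialDomain m D)) {z : ℂ} (hz : z ∈ D) (hz₀ : z.im ≠ 0)
    (hA : DifferentiableAt ℝ A (z.re, z.im ^ 2)) (hB : DifferentiableAt ℝ B (z.re, z.im ^ 2)) :
    ∂ᵤ A (z.re, z.im ^ 2) - (2 * z.im ^ 2) • ∂ₛ B (z.re, z.im ^ 2)
        - (m : ℝ) • B (z.re, z.im ^ 2) = 0 ∧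
      ∂ᵤ B (z.re, z.im ^ 2) + (2 : ℝ) • ∂ₛ A (z.re, z.im ^ 2) = 0 := by
  have hcr : ∀ v : Fin m → ℝ, ∑ j, v j ^ 2 = 1 →
      ∂ᵤ A (z.re, z.im ^ 2) - (2 * z.im ^ 2) • ∂ₛ B (z.re, z.im ^ 2)
        - (m : ℝ) • B (z.re, z.im ^ 2)
        + vec (z.im • v) * (∂ᵤ B (z.re, z.im ^ 2) + (2 : ℝ) • ∂ₛ A (z.re, z.im ^ 2)) = 0 := by
    intro v hv
    have hx := para_smul_mem hD hz hv
    have hcoord : axisCoord (para z.re (z.im • v)) = (z.re, z.im ^ 2) := by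
      rw [axisCoord_eq, rad_para hv, sq_abs]
      rfl
    have hmon := hF.2 _ hx
    rw [(hFAB.eventuallyEq_of_mem ((isOpen_axialDomain hD.1).mem_nhds hx)).fderiv_eq] at hmon
    have hsplit := cauchyRiemann_axialFn (hcoord ▸ hA) (hcoord ▸ hB)
    rw [hcoord] at hsplit
    exact hsplit.symm.trans hmon
  obtain ⟨w, hw, -⟩ := exists_polar hm 0
  refine eq_zero_of_vec_mul (v := z.im • w) ?_ (hcr w hw) ?_
  · simpa [mul_pow, ← Finset.mul_sum, hw] using hz₀
  · simpa only [smul_neg] using hcr (-w) (by simpa using hw)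

theorem axialSystem_eqs_of_im_pos (hm : 0 < m) (hD : IsIntrinsicDomain D)
    (hF : IsMonogenicOn (axialDomain m D) F) (hA : AnalyticOnNhd ℝ A D) (hB : AnalyticOnNhd ℝ B D)
    (hFAB : ∀ x ∈ axialDomain m D,
      F x = A ⟨x 0, rad x⟩ + ((rad x)⁻¹ • vecPart x) * B ⟨x 0, rad x⟩)
    {z : ℂ} (hz : z ∈ D) (hz₀ : 0 < z.im) :
    z.im • dirDeriv 1 A z = z.im • dirDeriv Complex.I B z + ((m : ℝ) - 1) • B z ∧
      dirDeriv Complex.I A z = -dirDeriv 1 B z := by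
  set C : ℂ → Cl m := fun ζ => ζ.im⁻¹ • B ζ
  have hAz := (hA z hz).differentiableAt
  have hCz : DifferentiableAt ℝ C z :=
    (Complex.imCLM.differentiableAt.fun_inv hz₀.ne').fun_smul (hB z hz).differentiableAt
  have hFAC : Set.EqOn F (axialFn (fun q => A (sqrtPt q)) (fun q => C (sqrtPt q)))
      (axialDomain m D) := fun x hx => by
    rw [hFAB x hx, smul_mul_assoc, ← mul_smul_comm]
    rfl
  have hBC (e : ℂ) : dirDeriv e B z = z.im • dirDeriv e C z + e.im • C z := by
    rw [← dirDeriv_im_smul hCz]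
    refine (dirDeriv_congr ?_ e).eq_of_nhds
    filter_upwards [(Complex.continuous_im.isOpen_preimage _ isOpen_ne).mem_nhds hz₀.ne']
      with ζ hζ using (smul_inv_smul₀ hζ _).symm
  have hBz : B z = z.im • C z := (smul_inv_smul₀ hz₀.ne' _).symm
  obtain ⟨hre, him⟩ := vekua_of_isMonogenicOn_axialFn hm hD hF hFAC hz hz₀.ne'
    (hasFDerivAt_comp_sqrtPt hz₀ hAz).differentiableAt
    (hasFDerivAt_comp_sqrtPt hz₀ hCz).differentiableAt
  rw [dirDeriv_fst_comp_sqrtPt hz₀ hAz, dirDeriv_snd_comp_sqrtPt hz₀ hCz, sqrtPt_mk_sq hz₀,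
    smul_smul, show 2 * z.im ^ 2 * (1 / (2 * z.im)) = z.im by field_simp, sub_sub,
    sub_eq_zero] at hre
  rw [dirDeriv_fst_comp_sqrtPt hz₀ hCz, dirDeriv_snd_comp_sqrtPt hz₀ hAz, smul_smul,
    show 2 * (1 / (2 * z.im)) = z.im⁻¹ by field_simp] at him
  constructor
  · rw [hre, hBC, hBz, Complex.I_im]
    module
  · rw [hBC, eq_neg_of_add_eq_zero_left him, smul_neg, smul_inv_smul₀ hz₀.ne', Complex.one_im,
      zero_smul, add_zero, neg_neg]

theorem continuous_mk_im (x : ℝ) : Continuous fun v : ℝ => (⟨x, v⟩ : ℂ) :=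
  Complex.equivRealProdCLM.symm.continuous.comp (Continuous.prodMk_right x)

theorem IsIntrinsicDomain.exists_im_pos (hD : IsIntrinsicDomain D) : ∃ z ∈ D, 0 < z.im := by
  obtain ⟨x, hx⟩ := realTrace_nonempty hD
  have hline : Tendsto (fun v : ℝ => (⟨x, v⟩ : ℂ)) (𝓝[>] 0) (𝓝 (x : ℂ)) :=
    ((continuous_mk_im x).tendsto' _ _ rfl).mono_left nhdsWithin_le_nhds
  obtain ⟨v, hv, hv₀⟩ :=
    ((hline.eventually (hD.1.mem_nhds hx)).and self_mem_nhdsWithin).exists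
  exact ⟨_, hv, hv₀⟩

theorem axialSystem_of_isMonogenicOn (hm : 0 < m) (hD : IsIntrinsicDomain D)
    (hF : IsMonogenicOn (axialDomain m D) F) (hA : AnalyticOnNhd ℝ A D) (hB : AnalyticOnNhd ℝ B D)
    (hodd : ∀ z ∈ D, B ((starRingEnd ℂ) z) = -B z)
    (hFAB : ∀ x ∈ axialDomain m D,
      F x = A ⟨x 0, rad x⟩ + ((rad x)⁻¹ • vecPart x) * B ⟨x 0, rad x⟩) :
    AxialSystem m D A B := by
  obtain ⟨z₀, hz₀, hz₀_pos⟩ := hD.exists_im_pos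
  have hev : ∀ᶠ z in 𝓝 z₀, z ∈ D ∧ 0 < z.im :=
    Filter.Eventually.and (hD.1.mem_nhds hz₀)
      (continuousAt_const.eventually_lt Complex.continuous_im.continuousAt hz₀_pos)
  have him (z : ℂ) : AnalyticAt ℝ (fun ζ : ℂ => ζ.im) z := Complex.imCLM.analyticAt z
  have heqs {z : ℂ} (hz : z ∈ D ∧ 0 < z.im) :=
    axialSystem_eqs_of_im_pos hm hD hF hA hB hFAB hz.1 hz.2
  refine ⟨hA, hB, ?_, ?_, fun x hx => ?_⟩
  · refine AnalyticOnNhd.eqOn_of_preconnected_of_eventuallyEq (𝕜 := ℝ)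
      (fun z hz => (him z).fun_smul (analyticAt_dirDeriv (hA z hz) 1))
      (fun z hz => ((him z).fun_smul (analyticAt_dirDeriv (hB z hz) Complex.I)).fun_add
        (analyticAt_const.fun_smul (hB z hz))) hD.2.1.isPreconnected hz₀ ?_
    filter_upwards [hev] with z hz using (heqs hz).1
  · refine AnalyticOnNhd.eqOn_of_preconnected_of_eventuallyEq (𝕜 := ℝ)
      (fun z hz => analyticAt_dirDeriv (hA z hz) Complex.I)
      (fun z hz => (analyticAt_dirDeriv (hB z hz) 1).fun_neg) hD.2.1.isPreconnected hz₀ ?_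
    filter_upwards [hev] with z hz using (heqs hz).2
  · have h := hodd x hx
    rw [Complex.conj_ofReal] at h
    have h₂ : (2 : ℝ) • B x = 0 := by
      rw [two_smul]
      nth_rewrite 1 [h]
      exact neg_add_cancel _
    exact (smul_eq_zero.1 h₂).resolve_left two_ne_zero

theorem gckTerm_eq_axialCoeff (hm : 0 < m) (g : ℝ → Cl m) (x : Para m) (k : ℕ) :
    gckTerm g x k =
      (rad x ^ (2 * k) * (axialCoeff m (2 * k)).1) • iteratedDeriv (2 * k) g (x 0)
        + ((rad x)⁻¹ • vecPart x) * ((rad x ^ (2 * k + 1) * (axialCoeff m (2 * k + 1)).2) •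
          iteratedDeriv (2 * k + 1) g (x 0)) := by
  obtain ⟨hfst, hsnd⟩ := axialCoeff_bessel (Nat.cast_pos.2 hm : (0 : ℝ) < m) k
  rcases eq_or_ne (rad x) 0 with hr | hr
  · simp only [gckTerm, hfst, vecPart_eq_zero_of_rad_eq_zero hr, hr, zero_div, smul_zero, zero_mul,
      add_zero, smul_smul]
    congr 1
    rcases k.eq_zero_or_pos with rfl | hk
    · simp
    · simp [hk.ne']
  · rw [gckTerm, hfst, hsnd]
    simp only [smul_add, smul_mul_assoc, mul_smul_comm, smul_smul, div_pow]
    congr 2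
    · field_simp
    · field_simp
      rw [mul_right_comm, ← pow_succ, mul_comm]

theorem hasSum_gckTerm (hm : 0 < m) (hD : IsIntrinsicDomain D) (hF : IsAxialMonogenic D F)
    (hg : ∀ x₀ ∈ realTrace D, F (para x₀ 0) = g x₀) (hx₀ : x₀ ∈ realTrace D) :
    ∀ᶠ x in 𝓝 (para x₀ 0 : Para m), HasSum (gckTerm g x) (F x) := by
  obtain ⟨-, hmon, A, B, hA, hB, -, hodd, hFAB⟩ := hF
  obtain ⟨ρ, hρ, hsum⟩ := (axialSystem_of_isMonogenicOn hm hD hmon hA hB hodd hFAB).exists_hasSum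
    (Nat.cast_pos.2 hm) hD.1 hx₀
  have hgA : ∀ u ∈ realTrace D, g u = A u := fun u hu => by
    rw [← hg u hu, hFAB _ (para_zero_mem hu), rad_para_zero, inv_zero, zero_smul, zero_mul,
      add_zero]
    rfl
  have hderiv := iteratedDeriv_eq_dirDeriv_one hD.1 hA hgA
  have hcoord : Continuous fun x : Para m => x 0 := by fun_prop
  have hrad : Continuous fun x : Para m => rad x := Complex.continuous_im.comp continuous_mk_rad
  have hcoord_lt : ∀ᶠ x in 𝓝 (para x₀ 0 : Para m), |x 0 - x₀| < ρ :=
    (hcoord.sub continuous_const).abs.continuousAt.eventually_lt continuousAt_const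
      (by simp [para, hρ])
  have hrad_lt : ∀ᶠ x in 𝓝 (para x₀ 0 : Para m), |rad x| < ρ :=
    hrad.abs.continuousAt.eventually_lt continuousAt_const (by simp [rad_para_zero, hρ])
  have hcoord_mem : ∀ᶠ x in 𝓝 (para x₀ 0 : Para m), x 0 ∈ realTrace D :=
    hcoord.continuousAt.eventually_mem ((isOpen_realTrace hD.1).mem_nhds hx₀)
  filter_upwards [hcoord_lt, hrad_lt, hcoord_mem,
    (isOpen_axialDomain hD.1).mem_nhds (para_zero_mem hx₀)] with x hx_lt hx_rad hx_mem hx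
  obtain ⟨hsumA, hsumB⟩ := hsum _ hx_mem hx_lt _ hx_rad
  have hterm (k : ℕ) := gckTerm_eq_axialCoeff hm g x k
  simp only [hderiv _ _ hx_mem] at hterm
  rw [hFAB x hx, funext hterm]
  exact hsumA.add ((mulL m ((rad x)⁻¹ • vecPart x)).hasSum hsumB)

theorem isGCKExtension_of_isAxialMonogenic (hm : 0 < m) (hD : IsIntrinsicDomain D)
    (hF : IsAxialMonogenic D F) (hg : ∀ x₀ ∈ realTrace D, F (para x₀ 0) = g x₀) :
    IsGCKExtension D g F :=
  ⟨hF, fun _ hx₀ => hasSum_gckTerm hm hD hF hg hx₀⟩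

theorem IsGCKExtension.eqOn (hm : 0 < m) (hD : IsIntrinsicDomain D) (hF : IsGCKExtension D g F)
    (hG : IsGCKExtension D g G) : Set.EqOn F G (axialDomain m D) := by
  obtain ⟨x₀, hx₀⟩ := realTrace_nonempty hD
  refine eqOn_axialDomain_of_eventuallyEq hm hD hF.1.1 hG.1.1 hx₀ ?_
  filter_upwards [hF.2 x₀ hx₀, hG.2 x₀ hx₀] with x hxF hxG using hxF.unique hxG

theorem gckWellDefined_of_isAxialMonogenic (hm : 0 < m) (hD : IsIntrinsicDomain D)
    (hF : IsAxialMonogenic D F) (hg : ∀ x₀ ∈ realTrace D, F (para x₀ 0) = g x₀) :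
    GCKWellDefined m D g ∧ Set.EqOn F (GCK m D g) (axialDomain m D) := by
  have hex : ∃ F : Para m → Cl m, IsGCKExtension D g F :=
    ⟨F, isGCKExtension_of_isAxialMonogenic hm hD hF hg⟩
  have hGCK : IsGCKExtension D g (GCK m D g) := by
    rw [GCK, dif_pos hex]
    exact hex.choose_spec
  have hunique : ∀ F : Para m → Cl m, IsAxialMonogenic D F →
      (∀ x₀ ∈ realTrace D, F (para x₀ 0) = g x₀) → Set.EqOn F (GCK m D g) (axialDomain m D) :=
    fun _ hF hg => (isGCKExtension_of_isAxialMonogenic hm hD hF hg).eqOn hm hD hGCK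
  refine ⟨⟨hGCK, fun x₀ hx₀ => ?_, hunique⟩, hunique F hF hg⟩
  rw [← hunique F hF hg (para_zero_mem hx₀), hg x₀ hx₀]

theorem IsAxialMonogenic.const_smul (hF : IsAxialMonogenic D F) (c : ℝ) :
    IsAxialMonogenic D fun x => c • F x := by
  obtain ⟨hanalytic, hmon, A, B, hA, hB, heven, hodd, hFAB⟩ := hF
  have hanalytic' : AnalyticOnNhd ℝ (fun x => c • F x) (axialDomain m D) := fun x hx =>
    analyticAt_const.fun_smul (hanalytic x hx)
  refine ⟨hanalytic', ⟨fun x hx => (hanalytic' x hx).contDiffAt.contDiffWithinAt, fun x hx => ?_⟩,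
    fun z => c • A z, fun z => c • B z, fun z hz => analyticAt_const.fun_smul (hA z hz),
    fun z hz => analyticAt_const.fun_smul (hB z hz), fun z hz => by simp only [heven z hz],
    fun z hz => by simp only [hodd z hz, smul_neg], fun x hx => ?_⟩
  · rw [fderiv_fun_const_smul (hanalytic x hx).differentiableAt]
    simp only [smul_apply, mul_smul_comm, ← Finset.smul_sum, ← smul_add]
    rw [hmon.2 x hx, smul_zero]
  · simp only [hFAB x hx, smul_add, mul_smul_comm]

theorem gckWellDefined_of_isAxialMonogenic_smul (hm : 0 < m) (hD : IsIntrinsicDomain D)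
    (hF : IsAxialMonogenic D F) {c : ℝ} (hc : c ≠ 0)
    (hg : ∀ x₀ ∈ realTrace D, F (para x₀ 0) = c • g x₀) :
    GCKWellDefined m D g ∧ ∀ x ∈ axialDomain m D, F x = c • GCK m D g x := by
  obtain ⟨hwd, heq⟩ := gckWellDefined_of_isAxialMonogenic hm hD (hF.const_smul c⁻¹) (g := g)
    fun x₀ hx₀ => by rw [hg x₀ hx₀, inv_smul_smul₀ hc]
  exact ⟨hwd, fun x hx => by rw [← heq hx, smul_inv_smul₀ hc]⟩

end GCKExtension

/-! ### The slice extension -/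

section SliceMonogenic

variable {E : Type*} [NormedAddCommGroup E] [NormedSpace ℝ E] {G : ℝ × ℝ → E} {z : ℂ}

theorem hasFDerivAt_re_im_sq (z : ℂ) : HasFDerivAt (fun ζ : ℂ => (ζ.re, ζ.im ^ 2))
    (Complex.reCLM.prod ((2 * z.im) • Complex.imCLM)) z := by
  have him : HasFDerivAt (fun ζ : ℂ => ζ.im) Complex.imCLM z := Complex.imCLM.hasFDerivAt
  simpa using Complex.reCLM.hasFDerivAt.prodMk (him.pow 2)

theorem hasFDerivAt_comp_im_sq (hG : DifferentiableAt ℝ G (z.re, z.im ^ 2)) :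
    HasFDerivAt (fun ζ : ℂ => G (ζ.re, ζ.im ^ 2)) ((fderiv ℝ G (z.re, z.im ^ 2)).comp
      (Complex.reCLM.prod ((2 * z.im) • Complex.imCLM))) z :=
  HasFDerivAt.comp z (g := G) hG.hasFDerivAt (hasFDerivAt_re_im_sq z)

theorem dirDeriv_comp_im_sq (hG : DifferentiableAt ℝ G (z.re, z.im ^ 2)) (e : ℂ) :
    dirDeriv e (fun ζ : ℂ => G (ζ.re, ζ.im ^ 2)) z =
      e.re • ∂ᵤ G (z.re, z.im ^ 2) + (2 * z.im * e.im) • ∂ₛ G (z.re, z.im ^ 2) := by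
  rw [dirDeriv, (hasFDerivAt_comp_im_sq hG).fderiv, dirDeriv, dirDeriv, ← map_smul, ← map_smul,
    ← map_add]
  simp

variable {m : ℕ} {D : Set ℂ} {A B : ℝ × ℝ → Cl m}

theorem VekuaAt.cauchyRiemann {z : ℂ} (h : VekuaAt 1 A B (z.re, z.im ^ 2)) :
    dirDeriv 1 (fun ζ : ℂ => A (ζ.re, ζ.im ^ 2)) z =
        dirDeriv Complex.I (fun ζ : ℂ => ζ.im • B (ζ.re, ζ.im ^ 2)) z ∧
      dirDeriv Complex.I (fun ζ : ℂ => A (ζ.re, ζ.im ^ 2)) z =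
        -dirDeriv 1 (fun ζ : ℂ => ζ.im • B (ζ.re, ζ.im ^ 2)) z := by
  obtain ⟨hA, hB, hAB⟩ := h
  obtain ⟨hre, him⟩ := hAB.self_of_nhds
  have hdB := dirDeriv_im_smul (hasFDerivAt_comp_im_sq hB.differentiableAt).differentiableAt
  simp only [hdB, dirDeriv_comp_im_sq hA.differentiableAt, dirDeriv_comp_im_sq hB.differentiableAt,
    hre, him, Complex.one_re, Complex.one_im, Complex.I_re, Complex.I_im]
  constructor <;> module

theorem axialFn_para_smul (A B : ℝ × ℝ → Cl m) {w : Fin m → ℝ} (hw : ∑ j, w j ^ 2 = 1) (u v : ℝ) :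
    axialFn A B (para u (v • w)) = A (u, v ^ 2) + vec w * (v • B (u, v ^ 2)) := by
  have hcoord : axisCoord (para u (v • w)) = (u, v ^ 2) := by
    rw [axisCoord_eq, rad_para hw, sq_abs]
    rfl
  have hvec : vecPart (para u (v • w)) = v • vec w := map_smul _ v w
  rw [axialFn, hcoord, hvec, smul_mul_assoc, mul_smul_comm]

theorem isSliceMonogenicOn_of_vekuaAt (hD : IsOpen D)
    (h : ∀ z ∈ D, VekuaAt 1 A B (z.re, z.im ^ 2)) {F : Para m → Cl m}
    (hF : Set.EqOn F (axialFn A B) (axialDomain m D)) :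
    IsSliceMonogenicOn (axialDomain m D) F := by
  intro w hw z hz
  have hv : VekuaAt 1 A B (z.re, z.im ^ 2) := by
    have hvek := h _ hz
    rwa [rad_para hw, sq_abs] at hvek
  set a : ℂ → Cl m := fun ζ => A (ζ.re, ζ.im ^ 2)
  set b : ℂ → Cl m := fun ζ => ζ.im • B (ζ.re, ζ.im ^ 2)
  have ha : DifferentiableAt ℝ a z :=
    (hasFDerivAt_comp_im_sq hv.1.differentiableAt).differentiableAt
  have hb : DifferentiableAt ℝ b z :=
    Complex.imCLM.differentiableAt.fun_smul
      (hasFDerivAt_comp_im_sq hv.2.1.differentiableAt).differentiableAt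
  have hwb : DifferentiableAt ℝ (fun ζ => vec w * b ζ) z :=
    (mulL m (vec w)).differentiableAt.comp z hb
  have hev : (fun ζ : ℂ => F (para ζ.re (ζ.im • w))) =ᶠ[𝓝 z] fun ζ => a ζ + vec w * b ζ := by
    have hcont : Continuous fun ζ : ℂ => para ζ.re (ζ.im • w) := by
      simpa only [← sliceL_apply] using (sliceL w).continuous
    filter_upwards [((isOpen_axialDomain hD).preimage hcont).mem_nhds hz] with ζ hζ
    rw [hF hζ, axialFn_para_smul A B hw]
  have hdir (e : ℂ) : dirDeriv e (fun ζ : ℂ => F (para ζ.re (ζ.im • w))) z =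
      dirDeriv e a z + vec w * dirDeriv e b z := by
    rw [(dirDeriv_congr hev e).eq_of_nhds, dirDeriv_add ha hwb]
    exact congrArg _ (dirDeriv_clm (mulL m (vec w)) hb e)
  refine ⟨(ha.add hwb).congr_of_eventuallyEq hev, ?_⟩
  obtain ⟨hre, him⟩ := hv.cauchyRiemann
  refine (congrArg₂ (fun y y' => y + vec w * y') (hdir 1) (hdir Complex.I)).trans ?_
  rw [hre, him, mul_add, vec_mul_vec_mul, hw, neg_one_smul, mul_neg]
  abel

end SliceMonogenic

section SliceExt

variable {m n n' : ℕ} {D : Set ℂ} {f : ℂ → ℂ} {h : Fin n → ℂ → ℂ} {c : Fin n → Cl m}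
  {h' : Fin n' → ℂ → ℂ} {c' : Fin n' → Cl m} {g : ℝ → Cl m} {z : ℂ} {x : Para m} {x₀ : ℝ}

theorem IsIntrinsicHol.ofReal_eq (hf : IsIntrinsicHol D f) (hx₀ : x₀ ∈ realTrace D) :
    f x₀ = alphaPart f x₀ 0 := by
  have h := hf.2 x₀ hx₀
  rw [Complex.conj_ofReal] at h
  exact (Complex.conj_eq_iff_re.1 h.symm).symm

theorem IsIntrinsicHol.alphaPart_zero_eq (hf : IsIntrinsicHol D f) (hx₀ : x₀ ∈ realTrace D) :
    alphaPart f x₀ 0 = realRestrict (evenPart f) (x₀, 0) := by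
  have h := (hf.re_im_eq hx₀).1
  rwa [Complex.ofReal_re, Complex.ofReal_im, zero_pow two_ne_zero] at h

theorem IsIntrinsicHol.vekuaAt_smul (hD : IsIntrinsicDomain D) (hf : IsIntrinsicHol D f)
    (hz : z ∈ D) (a : Cl m) :
    VekuaAt 1 (fun q => realRestrict (evenPart f) q • a) (fun q => realRestrict (oddPart f) q • a)
      (z.re, z.im ^ 2) :=
  (hf.vekuaAt hD hz).clm (ContinuousLinearMap.toSpanSingleton ℝ a)

theorem IsIntrinsicHol.sliceExtC_mul_eq_axialFn (hf : IsIntrinsicHol D f)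
    (hx : x ∈ axialDomain m D) (a : Cl m) :
    sliceExtC m f x * a = axialFn (fun q => realRestrict (evenPart f) q • a)
      (fun q => realRestrict (oddPart f) q • a) x := by
  obtain ⟨hre, him⟩ := hf.re_im_eq hx
  rw [sliceExtC, axialFn, alphaPart, betaPart, hre, him, ← axisCoord_eq, add_mul,
    ← Algebra.smul_def, smul_mul_assoc, mul_smul_comm]
  congr 1
  rcases eq_or_ne (rad x) 0 with hr | hr
  · rw [vecPart_eq_zero_of_rad_eq_zero hr, zero_mul, smul_zero, smul_zero]
  · rw [inv_mul_cancel_left₀ hr]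

/-- The stem function `A` of `∑ h_i c_i = A + v B`, in the variables `(u, v²)`. -/
def repEven (h : Fin n → ℂ → ℂ) (c : Fin n → Cl m) (q : ℝ × ℝ) : Cl m :=
  ∑ i, realRestrict (evenPart (h i)) q • c i

/-- The stem function `B` of `∑ h_i c_i = A + v B`, in the variables `(u, v²)`. -/
def repOdd (h : Fin n → ℂ → ℂ) (c : Fin n → Cl m) (q : ℝ × ℝ) : Cl m :=
  ∑ i, realRestrict (oddPart (h i)) q • c i

theorem IsHolRep.vekuaAt (hD : IsIntrinsicDomain D) (hg : IsHolRep D h c g) (hz : z ∈ D) :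
    VekuaAt 1 (repEven h c) (repOdd h c) (z.re, z.im ^ 2) :=
  VekuaAt.sum _ fun i _ => (hg.1 i).vekuaAt_smul hD hz (c i)

theorem IsHolRep.sum_sliceExtC_mul_eq_axialFn (hg : IsHolRep D h c g)
    (hx : x ∈ axialDomain m D) :
    ∑ i, sliceExtC m (h i) x * c i = axialFn (repEven h c) (repOdd h c) x := by
  rw [Finset.sum_congr rfl fun i _ => (hg.1 i).sliceExtC_mul_eq_axialFn hx (c i)]
  simp only [axialFn, repEven, repOdd, Finset.sum_add_distrib, Finset.mul_sum]

theorem IsHolRep.eq_repEven (hg : IsHolRep D h c g) (hx₀ : x₀ ∈ realTrace D) :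
    g x₀ = repEven h c (x₀, 0) := by
  rw [hg.2 x₀ hx₀]
  exact Finset.sum_congr rfl fun i _ => by rw [(hg.1 i).alphaPart_zero_eq hx₀]

theorem eqOn_of_eqOn_realTrace (hD : IsIntrinsicDomain D) {f g : ℂ → ℂ}
    (hf : DifferentiableOn ℂ f D) (hg : DifferentiableOn ℂ g D)
    (h : ∀ x ∈ realTrace D, f (x : ℂ) = g x) : Set.EqOn f g D := by
  obtain ⟨x₀, hx₀⟩ := realTrace_nonempty hD
  have hpunctured : Tendsto (fun t : ℝ => (t : ℂ)) (𝓝[≠] x₀) (𝓝[≠] (x₀ : ℂ)) :=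
    Complex.continuous_ofReal.continuousWithinAt.tendsto_nhdsWithin
      fun _ ht ht' => ht (Complex.ofReal_injective ht')
  refine (hf.analyticOnNhd hD.1).eqOn_of_preconnected_of_frequently_eq (hg.analyticOnNhd hD.1)
    hD.2.1.isPreconnected hx₀ (hpunctured.frequently (Eventually.frequently ?_))
  filter_upwards [nhdsWithin_le_nhds ((isOpen_realTrace hD.1).mem_nhds hx₀)] with t ht using h t ht

theorem IsHolRep.sum_mul_eq (hD : IsIntrinsicDomain D) (hg : IsHolRep D h c g)
    (hg' : IsHolRep D h' c' g) (l : Cl m →ₗ[ℝ] ℝ) (hz : z ∈ D) :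
    ∑ i, h i z * (l (c i) : ℂ) = ∑ i, h' i z * (l (c' i) : ℂ) := by
  refine eqOn_of_eqOn_realTrace hD
    (f := fun z => ∑ i, h i z * (l (c i) : ℂ)) (g := fun z => ∑ i, h' i z * (l (c' i) : ℂ))
    (DifferentiableOn.fun_sum fun i _ => (hg.1 i).1.mul_const _)
    (DifferentiableOn.fun_sum fun i _ => (hg'.1 i).1.mul_const _) (fun x hx => ?_) hz
  have hl : l (∑ i, alphaPart (h i) x 0 • c i) = l (∑ i, alphaPart (h' i) x 0 • c' i) :=
    congrArg l ((hg.2 x hx).symm.trans (hg'.2 x hx))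
  simp only [map_sum, map_smul, smul_eq_mul] at hl
  simp only [(hg.1 _).ofReal_eq hx, (hg'.1 _).ofReal_eq hx]
  exact_mod_cast hl

theorem IsHolRep.sum_re_im_smul_eq (hD : IsIntrinsicDomain D) (hg : IsHolRep D h c g)
    (hg' : IsHolRep D h' c' g) (hz : z ∈ D) :
    ∑ i, (h i z).re • c i = ∑ i, (h' i z).re • c' i ∧
      ∑ i, (h i z).im • c i = ∑ i, (h' i z).im • c' i := by
  have hcoord (S : Finset (Fin m)) := hg.sum_mul_eq hD hg' ((clBasis m).coord S) hz
  constructor <;> refine (clBasis m).ext_elem fun S => ?_ <;>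
    change (clBasis m).coord S _ = (clBasis m).coord S _ <;>
    simp only [map_sum, map_smul, smul_eq_mul]
  · simpa only [Complex.re_sum, Complex.re_mul_ofReal] using congrArg Complex.re (hcoord S)
  · simpa only [Complex.im_sum, Complex.im_mul_ofReal] using congrArg Complex.im (hcoord S)

theorem sum_sliceExtC_mul (h : Fin n → ℂ → ℂ) (c : Fin n → Cl m) (x : Para m) :
    ∑ i, sliceExtC m (h i) x * c i =
      ∑ i, (h i ⟨x 0, rad x⟩).re • c i +
        ((rad x)⁻¹ • vecPart x) * ∑ i, (h i ⟨x 0, rad x⟩).im • c i := by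
  rw [Finset.mul_sum, ← Finset.sum_add_distrib]
  refine Finset.sum_congr rfl fun i _ => ?_
  rw [sliceExtC, alphaPart, betaPart, add_mul, ← Algebra.smul_def, mul_smul_comm, smul_mul_assoc,
    smul_mul_assoc, smul_smul, mul_comm]

theorem sliceExt_eq (hD : IsIntrinsicDomain D) (hg : IsHolRep D h c g)
    (hx : x ∈ axialDomain m D) : sliceExt m D g x = ∑ i, sliceExtC m (h i) x * c i := by
  have hmem : MemA D g := ⟨n, h, c, hg⟩
  obtain ⟨hre, him⟩ := hmem.choose_spec.choose_spec.choose_spec.sum_re_im_smul_eq hD hg hx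
  rw [sliceExt, dif_pos hmem, sum_sliceExtC_mul, sum_sliceExtC_mul, hre, him]

end SliceExt

section MemA

variable {m : ℕ} {D : Set ℂ} {f : ℂ → ℂ} {g : ℝ → Cl m}

theorem IsIntrinsicHol.deriv (hD : IsOpen D) (hf : IsIntrinsicHol D f) :
    IsIntrinsicHol D (deriv f) := by
  refine ⟨hf.1.deriv hD, fun z hz => ?_⟩
  have hconj : HasDerivAt (fun ζ => (starRingEnd ℂ) (f ((starRingEnd ℂ) ζ)))
      ((starRingEnd ℂ) (_root_.deriv f z)) ((starRingEnd ℂ) z) :=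
    (hf.1.differentiableAt (hD.mem_nhds hz)).hasDerivAt.conj_conj
  have hmem : ∀ᶠ ζ in 𝓝 ((starRingEnd ℂ) z), (starRingEnd ℂ) ζ ∈ D :=
    Complex.continuous_conj.continuousAt.eventually_mem
      (hD.mem_nhds (by rwa [Complex.conj_conj]))
  refine (hconj.congr_of_eventuallyEq ?_).deriv
  filter_upwards [hmem] with ζ hζ
  rw [← hf.2 _ hζ, Complex.conj_conj]

theorem MemA.deriv (hD : IsOpen D) (hg : MemA D g) : MemA D (deriv g) := by
  obtain ⟨n, h, c, hh, hrep⟩ := hg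
  refine ⟨n, fun i => _root_.deriv (h i), c, fun i => (hh i).deriv hD, fun x hx => ?_⟩
  have hev : g =ᶠ[𝓝 x] fun t => ∑ i, alphaPart (h i) t 0 • c i :=
    Set.EqOn.eventuallyEq_of_mem hrep ((isOpen_realTrace hD).mem_nhds hx)
  rw [hev.deriv_eq]
  refine (HasDerivAt.fun_sum fun i _ => ?_).deriv
  have hi : HasDerivAt (h i) (_root_.deriv (h i) (x : ℂ)) (x : ℂ) :=
    ((hh i).1.differentiableAt (hD.mem_nhds hx)).hasDerivAt
  exact hi.real_of_complex.smul_const (c i)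

theorem MemA.iteratedDeriv (hD : IsOpen D) (hg : MemA D g) (k : ℕ) :
    MemA D (iteratedDeriv k g) := by
  induction k with
  | zero => rwa [iteratedDeriv_zero]
  | succ k ih => rw [iteratedDeriv_succ]; exact ih.deriv hD

theorem MemA.const_smul (hg : MemA D g) (t : ℝ) : MemA D fun x => t • g x := by
  obtain ⟨n, h, c, hh, hrep⟩ := hg
  refine ⟨n, h, fun i => t • c i, hh, fun x hx => ?_⟩
  simp only [hrep x hx, Finset.smul_sum]
  exact Finset.sum_congr rfl fun i _ => smul_comm _ _ _

end MemA

section RadialOp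

variable {a : ℝ → ℝ} {ψ : ℝ × ℝ → ℝ} {U : Set ℝ} {x₀ : ℝ}

theorem radialOp_comp_sq (hU : IsOpen U)
    (h : ∀ r ∈ U, AnalyticAt ℝ ψ (x₀, r ^ 2) ∧ a r = ψ (x₀, r ^ 2)) (k : ℕ) :
    ∀ r ∈ U, r ≠ 0 → radialOp k a r = 2 ^ k * ∂ₛ^[k] ψ (x₀, r ^ 2) := by
  induction k with
  | zero =>
    intro r hr _
    rw [pow_zero, one_mul]
    exact (h r hr).2
  | succ k ih =>
    intro r hr hr₀
    have hev : radialOp k a =ᶠ[𝓝 r] fun t => 2 ^ k * ∂ₛ^[k] ψ (x₀, t ^ 2) := by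
      filter_upwards [hU.mem_nhds hr, eventually_ne_nhds hr₀] with t ht ht₀ using ih t ht ht₀
    have hcurve : HasDerivAt (fun t : ℝ => ((x₀, t ^ 2) : ℝ × ℝ)) ((2 * r) • (0, 1)) r := by
      simpa using (hasDerivAt_const r x₀).prodMk ((hasDerivAt_id' r).fun_pow 2)
    have hderiv : HasDerivAt (fun t : ℝ => ∂ₛ^[k] ψ (x₀, t ^ 2))
        ((2 * r) • ∂ₛ (∂ₛ^[k] ψ) (x₀, r ^ 2)) r := by
      rw [dirDeriv, ← map_smul]
      exact (analyticAt_dirDeriv_iterate (h r hr).1 (0, 1)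
        k).differentiableAt.hasFDerivAt.comp_hasDerivAt r hcurve
    calc radialOp (k + 1) a r = r⁻¹ * deriv (radialOp k a) r := by
          simp only [radialOp, Function.iterate_succ_apply']
      _ = 2 ^ (k + 1) * ∂ₛ^[k + 1] ψ (x₀, r ^ 2) := by
          rw [hev.deriv_eq, (hderiv.const_mul _).deriv, Function.iterate_succ_apply', smul_eq_mul]
          field_simp
          ring

theorem tendsto_radialOp_comp_sq (hU : IsOpen U) (hU₀ : 0 ∈ U)
    (h : ∀ r ∈ U, AnalyticAt ℝ ψ (x₀, r ^ 2) ∧ a r = ψ (x₀, r ^ 2)) (k : ℕ) :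
    Tendsto (radialOp k a) (𝓝[≠] 0) (𝓝 (2 ^ k * ∂ₛ^[k] ψ (x₀, 0))) := by
  have hψ : ContinuousAt (∂ₛ^[k] ψ) (x₀, (0 : ℝ) ^ 2) :=
    (analyticAt_dirDeriv_iterate (h 0 hU₀).1 (0, 1) k).continuousAt
  have hcont : ContinuousAt (fun r : ℝ => 2 ^ k * ∂ₛ^[k] ψ (x₀, r ^ 2)) 0 :=
    continuousAt_const.mul
      (ContinuousAt.comp (f := fun r : ℝ => ((x₀, r ^ 2) : ℝ × ℝ)) hψ (by fun_prop))
  have hlim : Tendsto (fun r : ℝ => 2 ^ k * ∂ₛ^[k] ψ (x₀, r ^ 2)) (𝓝[≠] 0)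
      (𝓝 (2 ^ k * ∂ₛ^[k] ψ (x₀, 0))) := by
    have htend := hcont.tendsto.mono_left (nhdsWithin_le_nhds (s := {0}ᶜ))
    rwa [zero_pow two_ne_zero] at htend
  refine hlim.congr' ?_
  filter_upwards [self_mem_nhdsWithin, nhdsWithin_le_nhds (hU.mem_nhds hU₀)] with r hr₀ hr
    using (radialOp_comp_sq hU h k r hr hr₀).symm

theorem IsIntrinsicHol.tendsto_radialOp {D : Set ℂ} (hD : IsIntrinsicDomain D) {f : ℂ → ℂ}
    (hf : IsIntrinsicHol D f) (hx₀ : x₀ ∈ realTrace D) (k : ℕ) :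
    Tendsto (radialOp k (alphaPart f x₀)) (𝓝[≠] 0)
      (𝓝 (2 ^ k * ∂ₛ^[k] (realRestrict (evenPart f)) (x₀, 0))) :=
  tendsto_radialOp_comp_sq (hD.1.preimage (continuous_mk_im x₀)) hx₀
    (fun _ hr => ⟨(hf.vekuaAt hD hr).1, (hf.re_im_eq hr).1⟩) k

end RadialOp

/-! ### The Fueter–Sce map and the generalized CK-extension -/

section FueterSce

variable {m n : ℕ} {D : Set ℂ} {f : ℂ → ℂ} {f₀ : ℝ → Cl m} {x₀ : ℝ}

theorem gammaConst_mul (hm : m = 2 * n + 1) :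
    gammaConst m * ((-2) ^ n * (Nat.doubleFactorial (2 * n - 1) : ℝ)) =
      2 ^ n * (Nat.doubleFactorial (2 * n) : ℝ) := by
  have hne : (Nat.doubleFactorial (2 * n - 1) : ℝ) ≠ 0 :=
    Nat.cast_ne_zero.2 (Nat.doubleFactorial_pos _).ne'
  have hsign : (-1 : ℝ) ^ n * (-2) ^ n = 2 ^ n := by
    rw [← mul_pow]
    norm_num
  rw [gammaConst, show m - 1 = 2 * n by omega, show m - 2 = 2 * n - 1 by omega,
    Nat.mul_div_cancel_left n two_pos, ← hsign]
  field_simp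

theorem gammaConst_ne_zero (m : ℕ) : gammaConst m ≠ 0 := by
  have hne (k : ℕ) : (Nat.doubleFactorial k : ℝ) ≠ 0 :=
    Nat.cast_ne_zero.2 (Nat.doubleFactorial_pos k).ne'
  exact mul_ne_zero (pow_ne_zero _ (by norm_num)) (div_ne_zero (hne _) (hne _))

theorem IsIntrinsicHol.radialAtZero_eq (hD : IsIntrinsicDomain D) (hf : IsIntrinsicHol D f)
    (hx₀ : x₀ ∈ realTrace D) (k : ℕ) :
    radialAtZero k f x₀ = 2 ^ k * ∂ₛ^[k] (realRestrict (evenPart f)) (x₀, 0) :=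
  (hf.tendsto_radialOp hD hx₀ k).limUnder_eq

theorem IsIntrinsicHol.iteratedDeriv_alphaPart (hD : IsIntrinsicDomain D)
    (hf : IsIntrinsicHol D f) (hx₀ : x₀ ∈ realTrace D) (k : ℕ) :
    iteratedDeriv (2 * k) (fun t => alphaPart f t 0) x₀ =
      ((-2) ^ k * ((2 * k - 1).doubleFactorial : ℝ)) *
        ∂ₛ^[k] (realRestrict (evenPart f)) (x₀, 0) :=
  VekuaAt.iteratedDeriv_axis (isOpen_realTrace hD.1)
    (fun u hu => by simpa using hf.vekuaAt hD hu) (fun _ hu => hf.alphaPart_zero_eq hu) k x₀ hx₀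

theorem IsHolRep.iteratedDeriv_eq (hD : IsIntrinsicDomain D) {k : ℕ} {h : Fin k → ℂ → ℂ}
    {c : Fin k → Cl m} (hg : IsHolRep D h c f₀) (hx₀ : x₀ ∈ realTrace D) (n : ℕ) :
    iteratedDeriv (2 * n) f₀ x₀ =
      ((-2) ^ n * ((2 * n - 1).doubleFactorial : ℝ)) • ∂ₛ^[n] (repEven h c) (x₀, 0) :=
  VekuaAt.iteratedDeriv_axis (isOpen_realTrace hD.1)
    (fun u hu => by simpa using hg.vekuaAt hD hu) (fun _ hu => hg.eq_repEven hu) n x₀ hx₀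

theorem IsIntrinsicHol.eqOn_sliceExtC (hf : IsIntrinsicHol D f) :
    Set.EqOn (sliceExtC m f) (axialFn (fun q => realRestrict (evenPart f) q • (1 : Cl m))
      (fun q => realRestrict (oddPart f) q • 1)) (axialDomain m D) := fun x hx => by
  rw [← mul_one (sliceExtC m f x), hf.sliceExtC_mul_eq_axialFn hx]

theorem IsIntrinsicHol.analyticOnNhd_sliceExtC (hD : IsIntrinsicDomain D)
    (hf : IsIntrinsicHol D f) : AnalyticOnNhd ℝ (sliceExtC m f) (axialDomain m D) :=
  analyticOnNhd_of_vekuaAt hD.1 (fun _ hz => hf.vekuaAt_smul hD hz 1) hf.eqOn_sliceExtC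

theorem IsIntrinsicHol.isAxialMonogenic_laplacePow (hm : m = 2 * n + 1)
    (hD : IsIntrinsicDomain D) (hf : IsIntrinsicHol D f) :
    IsAxialMonogenic D (laplacePow n (sliceExtC m f)) :=
  FueterGCK.isAxialMonogenic_laplacePow hD.1 hm (fun _ hz => hf.vekuaAt_smul hD hz 1)
    hf.eqOn_sliceExtC

theorem IsIntrinsicHol.laplacePow_para_zero (hm : m = 2 * n + 1) (hD : IsIntrinsicDomain D)
    (hf : IsIntrinsicHol D f) (hx₀ : x₀ ∈ realTrace D) :
    laplacePow n (sliceExtC m f) (para x₀ 0) =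
      algebraMap ℝ (Cl m) (2 ^ n * ((2 * n).doubleFactorial : ℝ) *
        ∂ₛ^[n] (realRestrict (evenPart f)) (x₀, 0)) := by
  have haxis : AnalyticAt ℝ (realRestrict (evenPart f)) (x₀, 0) := by
    simpa using (hf.vekuaAt hD hx₀).1
  have hclm := dirDeriv_iterate_clm (ContinuousLinearMap.toSpanSingleton ℝ (1 : Cl m)) haxis
    (0, 1) n
  simp only [ContinuousLinearMap.toSpanSingleton_apply] at hclm
  rw [FueterGCK.laplacePow_para_zero hD.1 hm (fun _ hz => hf.vekuaAt_smul hD hz 1)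
    hf.eqOn_sliceExtC hx₀, hclm, smul_smul, Algebra.algebraMap_eq_smul_one]

theorem laplacePow_sliceExtC_eq_gck_radialAtZero (hm : m = 2 * n + 1) (hD : IsIntrinsicDomain D)
    (hf : IsIntrinsicHol D f) :
    GCKWellDefined m D (fun x₀ => algebraMap ℝ (Cl m) (radialAtZero n f x₀)) ∧
      ∀ x ∈ axialDomain m D, laplacePow n (sliceExtC m f) x =
        ((2 * n).doubleFactorial : ℝ) •
          GCK m D (fun x₀ => algebraMap ℝ (Cl m) (radialAtZero n f x₀)) x := by
  refine gckWellDefined_of_isAxialMonogenic_smul (by omega) hD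
    (hf.isAxialMonogenic_laplacePow hm hD)
    (Nat.cast_ne_zero.2 (Nat.doubleFactorial_pos _).ne') fun x₀ hx₀ => ?_
  rw [hf.laplacePow_para_zero hm hD hx₀, hf.radialAtZero_eq hD hx₀, Algebra.smul_def, ← map_mul]
  ring_nf

theorem laplacePow_sliceExtC_eq_gck_iteratedDeriv (hm : m = 2 * n + 1)
    (hD : IsIntrinsicDomain D) (hf : IsIntrinsicHol D f) :
    GCKWellDefined m D (fun x₀ => algebraMap ℝ (Cl m)
        (iteratedDeriv (2 * n) (fun t => alphaPart f t 0) x₀)) ∧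
      ∀ x ∈ axialDomain m D, laplacePow n (sliceExtC m f) x =
        gammaConst m • GCK m D (fun x₀ => algebraMap ℝ (Cl m)
          (iteratedDeriv (2 * n) (fun t => alphaPart f t 0) x₀)) x := by
  refine gckWellDefined_of_isAxialMonogenic_smul (by omega) hD
    (hf.isAxialMonogenic_laplacePow hm hD) (gammaConst_ne_zero m) fun x₀ hx₀ => ?_
  rw [hf.laplacePow_para_zero hm hD hx₀, hf.iteratedDeriv_alphaPart hD hx₀, Algebra.smul_def,
    ← map_mul, ← mul_assoc, gammaConst_mul hm]

theorem IsHolRep.eqOn_sliceExt (hD : IsIntrinsicDomain D) {k : ℕ} {h : Fin k → ℂ → ℂ}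
    {c : Fin k → Cl m} (hg : IsHolRep D h c f₀) :
    Set.EqOn (sliceExt m D f₀) (axialFn (repEven h c) (repOdd h c)) (axialDomain m D) :=
  fun _ hx => (sliceExt_eq hD hg hx).trans (hg.sum_sliceExtC_mul_eq_axialFn hx)

theorem analyticOnNhd_sliceExt (hD : IsIntrinsicDomain D) (hf₀ : MemA D f₀) :
    AnalyticOnNhd ℝ (sliceExt m D f₀) (axialDomain m D) := by
  obtain ⟨k, h, c, hrep⟩ := hf₀
  exact analyticOnNhd_of_vekuaAt hD.1 (fun _ hz => hrep.vekuaAt hD hz) (hrep.eqOn_sliceExt hD)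

theorem isSliceMonogenicOn_sliceExt (hD : IsIntrinsicDomain D) (hf₀ : MemA D f₀) :
    IsSliceMonogenicOn (axialDomain m D) (sliceExt m D f₀) := by
  obtain ⟨k, h, c, hrep⟩ := hf₀
  exact isSliceMonogenicOn_of_vekuaAt hD.1 (fun _ hz => hrep.vekuaAt hD hz)
    (hrep.eqOn_sliceExt hD)

theorem isAxialMonogenic_laplacePow_sliceExt (hm : m = 2 * n + 1) (hD : IsIntrinsicDomain D)
    (hf₀ : MemA D f₀) : IsAxialMonogenic D (laplacePow n (sliceExt m D f₀)) := by
  obtain ⟨k, h, c, hrep⟩ := hf₀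
  exact isAxialMonogenic_laplacePow hD.1 hm (fun _ hz => hrep.vekuaAt hD hz)
    (hrep.eqOn_sliceExt hD)

theorem laplacePow_sliceExt_eq_gck (hm : m = 2 * n + 1) (hD : IsIntrinsicDomain D)
    (hf₀ : MemA D f₀) :
    GCKWellDefined m D (fun x₀ => gammaConst m • iteratedDeriv (2 * n) f₀ x₀) ∧
      Set.EqOn (laplacePow n (sliceExt m D f₀))
        (GCK m D fun x₀ => gammaConst m • iteratedDeriv (2 * n) f₀ x₀) (axialDomain m D) := by
  refine gckWellDefined_of_isAxialMonogenic (by omega) hD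
    (isAxialMonogenic_laplacePow_sliceExt hm hD hf₀) fun x₀ hx₀ => ?_
  obtain ⟨k, h, c, hrep⟩ := hf₀
  rw [laplacePow_para_zero hD.1 hm (fun _ hz => hrep.vekuaAt hD hz) (hrep.eqOn_sliceExt hD) hx₀,
    hrep.iteratedDeriv_eq hD hx₀, smul_smul, gammaConst_mul hm]

end FueterSce

end FueterGCK

end

theorem theorem4p2 (m : ℕ) (hm : Odd m) (D : Set ℂ) (hD : FueterGCK.IsIntrinsicDomain D) :
    -- the two formulas, for an intrinsic holomorphic function `f = α + iβ`
    (∀ f : ℂ → ℂ, FueterGCK.IsIntrinsicHol D f →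
      (∀ x₀ ∈ FueterGCK.realTrace D,
        Filter.Tendsto
          (FueterGCK.radialOp ((m - 1) / 2) (FueterGCK.alphaPart f x₀))
          (nhdsWithin (0 : ℝ) {0}ᶜ)
          (nhds (FueterGCK.radialAtZero ((m - 1) / 2) f x₀))) ∧
      AnalyticOnNhd ℝ (FueterGCK.sliceExtC m f) (FueterGCK.axialDomain m D) ∧
      FueterGCK.GCKWellDefined m D
        (fun x₀ => algebraMap ℝ (FueterGCK.Cl m)
          (FueterGCK.radialAtZero ((m - 1) / 2) f x₀)) ∧
      FueterGCK.GCKWellDefined m D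
        (fun x₀ => algebraMap ℝ (FueterGCK.Cl m)
          (iteratedDeriv (m - 1) (fun t : ℝ => FueterGCK.alphaPart f t 0) x₀)) ∧
      ∀ x ∈ FueterGCK.axialDomain m D,
        FueterGCK.laplacePow ((m - 1) / 2) (FueterGCK.sliceExtC m f) x
          = (Nat.doubleFactorial (m - 1) : ℝ) •
            FueterGCK.GCK m D
              (fun x₀ => algebraMap ℝ (FueterGCK.Cl m)
                (FueterGCK.radialAtZero ((m - 1) / 2) f x₀)) x ∧
        FueterGCK.laplacePow ((m - 1) / 2) (FueterGCK.sliceExtC m f) x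
          = FueterGCK.gammaConst m •
            FueterGCK.GCK m D
              (fun x₀ => algebraMap ℝ (FueterGCK.Cl m)
                (iteratedDeriv (m - 1) (fun t : ℝ => FueterGCK.alphaPart f t 0) x₀)) x) ∧
    -- the commutative diagram `Δ^{(m-1)/2} ∘ S = GCK ∘ (γ_m ∂_{x_0}^{m-1})`
    (∀ f₀ : ℝ → FueterGCK.Cl m, FueterGCK.MemA D f₀ →
      (∀ (n : ℕ) (h : Fin n → ℂ → ℂ) (c : Fin n → FueterGCK.Cl m),
        FueterGCK.IsHolRep D h c f₀ →
        ∀ x ∈ FueterGCK.axialDomain m D,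
          FueterGCK.sliceExt m D f₀ x = ∑ i, FueterGCK.sliceExtC m (h i) x * c i) ∧
      AnalyticOnNhd ℝ (FueterGCK.sliceExt m D f₀) (FueterGCK.axialDomain m D) ∧
      FueterGCK.IsSliceMonogenicOn (FueterGCK.axialDomain m D) (FueterGCK.sliceExt m D f₀) ∧
      FueterGCK.IsAxialMonogenic D
        (FueterGCK.laplacePow ((m - 1) / 2) (FueterGCK.sliceExt m D f₀)) ∧
      FueterGCK.MemA D (fun x₀ => FueterGCK.gammaConst m • iteratedDeriv (m - 1) f₀ x₀) ∧
      FueterGCK.GCKWellDefined m D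
        (fun x₀ => FueterGCK.gammaConst m • iteratedDeriv (m - 1) f₀ x₀) ∧
      ∀ x ∈ FueterGCK.axialDomain m D,
        FueterGCK.laplacePow ((m - 1) / 2) (FueterGCK.sliceExt m D f₀) x
          = FueterGCK.GCK m D
              (fun x₀ => FueterGCK.gammaConst m • iteratedDeriv (m - 1) f₀ x₀) x) := by
  obtain ⟨n, hn⟩ := hm
  rw [show (m - 1) / 2 = n by omega, show m - 1 = 2 * n by omega]
  refine ⟨fun f hf => ?_, fun f₀ hf₀ => ?_⟩
  · obtain ⟨hwell, hradial⟩ := FueterGCK.laplacePow_sliceExtC_eq_gck_radialAtZero hn hD hf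
    obtain ⟨hwell', hderiv⟩ := FueterGCK.laplacePow_sliceExtC_eq_gck_iteratedDeriv hn hD hf
    refine ⟨fun x₀ hx₀ => ?_, hf.analyticOnNhd_sliceExtC hD, hwell, hwell',
      fun x hx => ⟨hradial x hx, hderiv x hx⟩⟩
    rw [hf.radialAtZero_eq hD hx₀]
    exact hf.tendsto_radialOp hD hx₀ n
  · obtain ⟨hwell, hgck⟩ := FueterGCK.laplacePow_sliceExt_eq_gck hn hD hf₀
    exact ⟨fun _ _ _ hrep _ hx => FueterGCK.sliceExt_eq hD hrep hx,
      FueterGCK.analyticOnNhd_sliceExt hD hf₀, FueterGCK.isSliceMonogenicOn_sliceExt hD hf₀,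
      FueterGCK.isAxialMonogenic_laplacePow_sliceExt hn hD hf₀,
      (hf₀.iteratedDeriv hD.1 (2 * n)).const_smul _, hwell, hgck⟩
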